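/- Let $\mathrm K=[0,1]^2$. For a bounded signed Borel measure $m$ on $\mathbb R^2$ let $\|m\|_{\mathcal M}$ be its total variation; for a closed set $S\subset\mathbb R^2$ let $\mathcal M(S)$ be the set of bounded signed measures supported in $S$. All derivatives below are taken in the sense of distributions: $\mathrm D\otimes\mathrm I=\partial_{x_1}$, $\mathrm I\otimes\mathrm D=\partial_{x_2}$, $\mathrm D\otimes\mathrm D=\partial_{x_1}\partial_{x_2}$. Let $\mathcal M^+_{\mathrm D\otimes\mathrm D,0}(\mathrm K)$ be the cone of real distributions $f\in\mathcal D'(\mathbb R^2)$ such that $[\mathrm D\otimes\mathrm D]\{f\}\in\mathcal M(\mathrm K)$, $\langle f,\phi\rangle=0$ for all $\phi\in\mathcal C_c^\infty(\mathbb R^2\setminus\mathrm K)$, and $\langle f,\phi\rangle\ge 0$ for all $\phi\in\mathcal C_c^\infty(\mathbb R^2)$ with $\phi\ge 0$; its elements are integrable functions. For $\theta\in(0,1]$ set $$\|f\|_\theta=\theta\,\|[\mathrm D\otimes\mathrm D]\{f\}\|_{\mathcal M}+(1-\theta)\big(\|[\mathrm I\otimes\mathrm D]\{f\}\|_{\mathcal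 M}+\|[\mathrm D\otimes\mathrm I]\{f\}\|_{\mathcal M}\big).$$ Let $N\ge 0$ be an integer, let $\mathcal X_N=\{(i2^{-N},j2^{-N}):0\le i,j\le 2^N\}$, and let $$\mathcal M^+_{\mathrm D\otimes\mathrm D,0}(\mathcal X_N)=\{f\in\mathcal M^+_{\mathrm D\otimes\mathrm D,0}(\mathrm K):[\mathrm D\otimes\mathrm D]\{f\}\in\mathcal M(\mathcal X_N)\}.$$ For $1\le n_1,n_2\le 2^N$ let $E_{n_1,n_2}=\big[\tfrac{n_1-1}{2^N},\tfrac{n_1}{2^N}\big]\times\big[\tfrac{n_2-1}{2^N},\tfrac{n_2}{2^N}\big]$ and $[\boldsymbol\nu\{f\}]_{n_1,n_2}=\int_{E_{n_1,n_2}}f(x)\,\mathrm dx$. Let $\mathbf y\in\mathbb R^{2^N\times 2^N}$, $\lambda\ge 0$, $\theta\in(0,1]$, put $$\mathcal J(f)=\|\mathbf y-\boldsymbol\nu\{f\}\|_2^2+\lambda\|f\|_\theta,$$ where $\|\cdot\|_2^2$ is the sum of the squares of the entries, and let $$\mathcal V=\operatorname*{argmin}_{f\in\mathcal M^+_{\mathrm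 D\otimes\mathrm D,0}(\mathrm K)}\mathcal J(f),\qquad \mathcal V_N=\operatorname*{argmin}_{f\in\mathcal M^+_{\mathrm D\otimes\mathrm D,0}(\mathcal X_N)}\mathcal J(f).$$ Then there is a distribution $f^\star$ such that $\mathcal V_N=\{f^\star\}$ and $f^\star\in\mathcal V$; moreover, $f^\star$ is the only element of $\mathcal V$ that lies in $\mathcal M^+_{\mathrm D\otimes\mathrm D,0}(\mathcal X_N)$. -/

import Mathlib

open MeasureTheory Set
open scoped Distributions LineDeriv ENNReal

noncomputable section

namespace MixedTV

/-- Smooth compactly supported test functions on the plane. -/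
abbrev Test : Type := 𝓓((⊤ : TopologicalSpace.Opens (ℝ × ℝ)), ℝ)

/-- Real distributions on the plane. -/
abbrev Distr : Type := 𝓓'((⊤ : TopologicalSpace.Opens (ℝ × ℝ)), ℝ)

/-- The distributional derivative `D ⊗ I` in the first variable. -/
def D₁ (f : Distr) : Distr := ∂_{((1, 0) : ℝ × ℝ)} f

/-- The distributional derivative `I ⊗ D` in the second variable. -/
def D₂ (f : Distr) : Distr := ∂_{((0, 1) : ℝ × ℝ)} f

/-- The mixed distributional derivative `D ⊗ D`. -/
def D₁₂ (f : Distr) : Distr := D₁ (D₂ f)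

/-- The distribution `T` is (integration against) the bounded signed measure `m`. -/
def IsMeasure (T : Distr) (m : SignedMeasure (ℝ × ℝ)) : Prop :=
  ∀ φ : Test, T φ = ∫ᵛ x, φ x ∂•m

/-- `T` belongs to `ℳ(S)`: it is a bounded signed measure carried by `S`.
(Only used for closed sets `S`, where this means that its support lies in `S`.) -/
def IsMeasureOn (T : Distr) (S : Set (ℝ × ℝ)) : Prop :=
  ∃ m : SignedMeasure (ℝ × ℝ), IsMeasure T m ∧ m.variation Sᶜ = 0

/-- The total-variation norm `‖T‖_ℳ`. A distribution is given by at most one bounded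
signed measure, so this is the total variation of that measure, and `∞` if there is none. -/
def normM (T : Distr) : ℝ≥0∞ :=
  ⨅ (m : SignedMeasure (ℝ × ℝ)) (_ : IsMeasure T m), m.variation univ

/-- The unit square `K = [0,1]²`. -/
def K : Set (ℝ × ℝ) := Icc 0 1 ×ˢ Icc 0 1

/-- The native space `ℳ_{D⊗D,0}(K)`. -/
def native : Set Distr :=
  {f | IsMeasureOn (D₁₂ f) K ∧ ∀ φ : Test, tsupport φ ⊆ Kᶜ → f φ = 0}

/-- The cone `ℳ⁺_{D⊗D,0}(K)` of nonnegative elements of the native space. -/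
def nativePos : Set Distr :=
  {f | f ∈ native ∧ ∀ φ : Test, (∀ x, 0 ≤ φ x) → 0 ≤ f φ}

/-- The norm `‖f‖_θ = θ ‖D⊗D f‖_ℳ + (1 - θ) (‖I⊗D f‖_ℳ + ‖D⊗I f‖_ℳ)`, for `θ ∈ [0,1]`. -/
def normTheta (θ : ℝ) (f : Distr) : ℝ≥0∞ :=
  ENNReal.ofReal θ * normM (D₁₂ f) +
    ENNReal.ofReal (1 - θ) * (normM (D₂ f) + normM (D₁ f))

/-- The dyadic grid of the `(2^n + 1)²` points `(i / 2^n, j / 2^n)`, `0 ≤ i, j ≤ 2^n`. -/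
def grid (n : ℕ) : Set (ℝ × ℝ) :=
  {x | ∃ i j : ℕ, i ≤ 2 ^ n ∧ j ≤ 2 ^ n ∧ x = ((i : ℝ) / 2 ^ n, (j : ℝ) / 2 ^ n)}

/-- The discretized cone: elements of `nativePos` with knots on the grid of level `n`. -/
def nativePosGrid (n : ℕ) : Set Distr :=
  {f | f ∈ nativePos ∧ IsMeasureOn (D₁₂ f) (grid n)}

/-- The pixels of resolution `N`; the indices run from `0` to `2^N - 1`. -/
def pixel (N : ℕ) (i j : Fin (2 ^ N)) : Set (ℝ × ℝ) :=
  Icc ((i : ℝ) / 2 ^ N) (((i : ℝ) + 1) / 2 ^ N) ×ˢ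
    Icc ((j : ℝ) / 2 ^ N) (((j : ℝ) + 1) / 2 ^ N)

/-- The distribution `f` is the locally integrable function `g`. -/
def IsFunction (f : Distr) (g : ℝ × ℝ → ℝ) : Prop :=
  LocallyIntegrable g ∧ ∀ φ : Test, f φ = ∫ x, g x * φ x

open Classical in
/-- A locally integrable function representing `f`; it is unique almost everywhere.
Every element of `native` has one; for other distributions the value `0` is a dummy. -/
def density (f : Distr) : ℝ × ℝ → ℝ :=
  if h : ∃ g, IsFunction f g then h.choose else 0

/-- The measurements `ν{f}`: the integrals of `f` over the pixels of resolution `N`. -/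
def pixelIntegrals (N : ℕ) (f : Distr) (i j : Fin (2 ^ N)) : ℝ :=
  ∫ x in pixel N i j, density f x

/-- The denoising functional `‖y - ν{f}‖₂² + lam ‖f‖_θ`. -/
def loss (N : ℕ) (y : Fin (2 ^ N) → Fin (2 ^ N) → ℝ) (lam θ : ℝ) (f : Distr) : ℝ≥0∞ :=
  ENNReal.ofReal (∑ i, ∑ j, (y i j - pixelIntegrals N f i j) ^ 2) +
    ENNReal.ofReal lam * normTheta θ f

/-- The set of minimizers of `J` over `C`. -/
def argmin (C : Set Distr) (J : Distr → ℝ≥0∞) : Set Distr :=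
  {f | f ∈ C ∧ ∀ g ∈ C, J f ≤ J g}

/-- The solution set `𝒱` of the continuous-domain denoising problem. -/
def solutions (N : ℕ) (y : Fin (2 ^ N) → Fin (2 ^ N) → ℝ) (lam θ : ℝ) : Set Distr :=
  argmin nativePos (loss N y lam θ)

/-- The solution set `𝒱_n` of the denoising problem discretized on the grid of level `n`. -/
def gridSolutions (N : ℕ) (y : Fin (2 ^ N) → Fin (2 ^ N) → ℝ) (lam θ : ℝ) (n : ℕ) :
    Set Distr :=
  argmin (nativePosGrid n) (loss N y lam θ)

end MixedTV

end

/-!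
A distribution `f` vanishing off `K` whose mixed derivative is a measure `m` is the function
`x ↦ m (-∞, x]`. In particular `[D ⊗ D]{f}` is carried by the grid exactly when `f` is constant
on the half-open cells of the grid, so such an `f` is determined by its cell integrals.

The key point is that replacing `f` by the step function with the same cell integrals does not
increase `‖f‖_θ`; the data term sees only these integrals. The penalty of a step function is a
weighted `ℓ¹` norm of differences of its cell integrals. By duality the same expression is a
lower bound for `‖f‖_θ`: pair the derivatives of `f` with smooth approximations of the cell
indicators that have been averaged along edges of the grid. The averages still sum to at
most `1`, and averaging turns derivatives into differences.

Both problems thus reduce to minimizing `‖y - x‖² + λ R x` over nonnegative arrays `x`, with `R`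
convex and nonnegative, and this problem has exactly one solution.
-/

noncomputable section

namespace MixedTV

open Filter Topology
open TopologicalSpace (Opens)
open scoped ContDiff

section SegmentIntegral

variable {E : Type*} [NormedAddCommGroup E] [NormedSpace ℝ E]

/-- A smooth compactly supported function, bundled as a test function on the whole space. -/
def mkTest (u : E → ℝ) (hu : ContDiff ℝ ∞ u) (hc : HasCompactSupport u) :
    𝓓((⊤ : Opens E), ℝ) :=
  ⟨u, hu, hc, subset_univ _⟩

@[simp] theorem mkTest_apply (u : E → ℝ) (hu : ContDiff ℝ ∞ u) (hc : HasCompactSupport u)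
    (x : E) : mkTest u hu hc x = u x := rfl

theorem lineDerivOp_apply (v : E) (φ : 𝓓((⊤ : Opens E), ℝ)) (x : E) :
    (∂_{v} φ) x = lineDeriv ℝ φ x v :=
  TestFunction.lineDerivCLM_apply_of_le (𝕜 := ℝ) (by simp)

/-- The translate `x ↦ φ (x + v)` of a test function. -/
def translate (v : E) (φ : 𝓓((⊤ : Opens E), ℝ)) :
    𝓓((⊤ : Opens E), ℝ) :=
  mkTest (fun x => φ (x + v)) (φ.contDiff.comp (by fun_prop))
    (φ.hasCompactSupport.comp_homeomorph (Homeomorph.addRight v))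

@[simp] theorem translate_apply (v : E) (φ : 𝓓((⊤ : Opens E), ℝ)) (x : E) :
    translate v φ x = φ (x + v) := rfl

theorem translate_translate (v w : E) (φ : 𝓓((⊤ : Opens E), ℝ)) :
    translate v (translate w φ) = translate (v + w) φ := by
  ext x
  simp only [translate_apply, add_assoc]

theorem tsupport_translate (v : E) (φ : 𝓓((⊤ : Opens E), ℝ)) :
    tsupport (translate v φ) = (· + v) ⁻¹' tsupport φ :=
  tsupport_comp_eq_preimage φ (Homeomorph.addRight v)

section SegmentMeasure

variable [MeasurableSpace E] [BorelSpace E]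

/-- The uniform probability measure on the segment from `x` to `x + v`. -/
def segmentMeasure (x v : E) : Measure E :=
  (volume.restrict (Ioc (0 : ℝ) 1)).map fun t => x + t • v

instance (x v : E) : IsProbabilityMeasure (segmentMeasure x v) := by
  have : IsProbabilityMeasure (volume.restrict (Ioc (0 : ℝ) 1)) := ⟨by simp⟩
  exact Measure.isProbabilityMeasure_map (Continuous.aemeasurable (by fun_prop))

theorem integral_segmentMeasure {f : E → ℝ} (hf : Continuous f) (hc : HasCompactSupport f)
    (x v : E) : ∫ y, f y ∂segmentMeasure x v = ∫ t in (0 : ℝ)..1, f (x + t • v) := by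
  rw [segmentMeasure, integral_map (Continuous.aemeasurable (by fun_prop))
    (hf.stronglyMeasurable_of_hasCompactSupport hc).aestronglyMeasurable,
    intervalIntegral.integral_of_le zero_le_one]

end SegmentMeasure

theorem hasCompactSupport_integral_segment {φ : E → ℝ} (hφ : HasCompactSupport φ) (v : E) :
    HasCompactSupport fun x => ∫ t in (0 : ℝ)..1, φ (x + t • v) := by
  have hcompact : IsCompact ((fun p : E × ℝ => p.1 - p.2 • v) '' (tsupport φ ×ˢ Icc 0 1)) :=
    (hφ.isCompact.prod isCompact_Icc).image (by fun_prop)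
  refine .intro hcompact fun x hx => ?_
  rw [intervalIntegral.integral_of_le zero_le_one]
  refine setIntegral_eq_zero_of_forall_eq_zero fun t ht => ?_
  by_contra hne
  exact hx ⟨(x + t • v, t), ⟨subset_tsupport φ hne, Ioc_subset_Icc_self ht⟩, by simp⟩

-- Averaging along `v` is convolution with the uniform measure on the reflected segment.
theorem contDiff_integral_segment {φ : E → ℝ} (hφ : ContDiff ℝ ∞ φ) (hc : HasCompactSupport φ)
    (v : E) : ContDiff ℝ ∞ fun x => ∫ t in (0 : ℝ)..1, φ (x + t • v) := by
  borelize E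
  have hconv : (fun x => ∫ t in (0 : ℝ)..1, φ (x + t • v)) =
      convolution (fun _ : E => (1 : ℝ)) φ (ContinuousLinearMap.lsmul ℝ ℝ)
        (segmentMeasure 0 (-v)) := by
    ext x
    simpa [convolution] using (integral_segmentMeasure (f := fun y => φ (x - y))
      (hφ.continuous.comp (by fun_prop)) (hc.comp_homeomorph (Homeomorph.subLeft x)) 0 (-v)).symm
  rw [hconv]
  exact hc.contDiff_convolution_right _ (locallyIntegrable_const _) hφ

/-- The average `x ↦ ∫ t in 0..1, φ (x + t v)` of a test function along the segments
parallel to `v`. It inverts differentiation: its derivative along `v` is a difference of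
translates of `φ`. -/
def segmentAverage (v : E) (φ : 𝓓((⊤ : Opens E), ℝ)) :
    𝓓((⊤ : Opens E), ℝ) :=
  mkTest (fun x => ∫ t in (0 : ℝ)..1, φ (x + t • v))
    (contDiff_integral_segment φ.contDiff φ.hasCompactSupport v)
    (hasCompactSupport_integral_segment φ.hasCompactSupport v)

theorem segmentAverage_apply (v : E) (φ : 𝓓((⊤ : Opens E), ℝ)) (x : E) :
    segmentAverage v φ x = ∫ t in (0 : ℝ)..1, φ (x + t • v) := rfl

theorem translate_segmentAverage (v w : E) (φ : 𝓓((⊤ : Opens E), ℝ)) :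
    translate w (segmentAverage v φ) = segmentAverage v (translate w φ) := by
  ext x
  simp only [translate_apply, segmentAverage_apply, add_right_comm]

theorem segmentAverage_sub (v : E) (φ ψ : 𝓓((⊤ : Opens E), ℝ)) :
    segmentAverage v (φ - ψ) = segmentAverage v φ - segmentAverage v ψ := by
  ext x
  have hint (φ : 𝓓((⊤ : Opens E), ℝ)) :
      IntervalIntegrable (fun t : ℝ => φ (x + t • v)) volume 0 1 :=
    (φ.continuous.comp (by fun_prop)).intervalIntegrable _ _
  exact intervalIntegral.integral_sub (hint φ) (hint ψ)

theorem segmentAverage_comm (v w : E) (φ : 𝓓((⊤ : Opens E), ℝ)) :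
    segmentAverage v (segmentAverage w φ) = segmentAverage w (segmentAverage v φ) := by
  ext x
  have hcont : Continuous fun p : ℝ × ℝ => φ (x + p.1 • v + p.2 • w) :=
    φ.continuous.comp (by fun_prop)
  have hint : IntegrableOn (fun p : ℝ × ℝ => φ (x + p.1 • v + p.2 • w))
      (uIoc 0 1 ×ˢ uIoc 0 1) :=
    (hcont.continuousOn.integrableOn_compact (isCompact_uIcc.prod isCompact_uIcc)).mono_set
      (prod_mono uIoc_subset_uIcc uIoc_subset_uIcc)
  simp_rw [segmentAverage_apply, add_right_comm x (_ • w)]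
  exact intervalIntegral_intervalIntegral_swap hint

theorem segmentAverage_nonneg (v : E) {φ : 𝓓((⊤ : Opens E), ℝ)} (hφ : ∀ x, 0 ≤ φ x) (x : E) :
    0 ≤ segmentAverage v φ x :=
  intervalIntegral.integral_nonneg zero_le_one fun _ _ => hφ _

theorem sum_segmentAverage_le_one {ι : Type*} {s : Finset ι} {ψ : ι → 𝓓((⊤ : Opens E), ℝ)}
    (hψ : ∀ x, ∑ p ∈ s, ψ p x ≤ 1) (v : E) (x : E) : ∑ p ∈ s, segmentAverage v (ψ p) x ≤ 1 := by
  have hcont (p : ι) : Continuous fun t : ℝ => ψ p (x + t • v) :=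
    (ψ p).continuous.comp (by fun_prop)
  simp_rw [segmentAverage_apply]
  rw [← intervalIntegral.integral_finsetSum fun p _ => (hcont p).intervalIntegrable _ _]
  refine (intervalIntegral.integral_mono_on (g := fun _ => (1 : ℝ)) zero_le_one
    ((continuous_finsetSum s fun p _ => hcont p).intervalIntegrable _ _)
    intervalIntegrable_const fun t _ => hψ _).trans ?_
  simp

theorem segmentAverage_lineDerivOp (v : E) (φ : 𝓓((⊤ : Opens E), ℝ)) :
    segmentAverage v (∂_{v} φ) = translate v φ - φ := by
  ext x
  have hderiv (t : ℝ) : HasDerivAt (fun t : ℝ => φ (x + t • v)) ((∂_{v} φ) (x + t • v)) t := by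
    have hdiff := ((φ.contDiff.differentiable (by simp)) (x + t • v))
    have hline : HasDerivAt (fun t : ℝ => x + t • v) v t := by
      simpa using ((hasDerivAt_id t).smul_const v).const_add x
    rw [lineDerivOp_apply, hdiff.lineDeriv_eq_fderiv]
    exact hdiff.hasFDerivAt.comp_hasDerivAt t hline
  rw [segmentAverage_apply, intervalIntegral.integral_eq_sub_of_hasDerivAt (fun t _ => hderiv t)
    (((∂_{v} φ).continuous.comp (by fun_prop)).intervalIntegrable _ _)]
  simp

theorem lineDerivOp_segmentAverage (v : E) (φ : 𝓓((⊤ : Opens E), ℝ)) :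
    ∂_{v} (segmentAverage v φ) = translate v φ - φ := by
  ext x
  rw [lineDerivOp_apply]
  have hcont : Continuous fun s : ℝ => φ (x + s • v) := φ.continuous.comp (by fun_prop)
  have hshift (t : ℝ) : segmentAverage v φ (x + t • v) =
      (∫ s in (0 : ℝ)..1 + t, φ (x + s • v)) - ∫ s in (0 : ℝ)..t, φ (x + s • v) := by
    rw [intervalIntegral.integral_interval_sub_left (hcont.intervalIntegrable _ _)
      (hcont.intervalIntegrable _ _), segmentAverage_apply]
    simpa [add_smul, add_assoc, add_comm, add_left_comm] using
      intervalIntegral.integral_comp_add_right (a := 0) (b := 1) (fun s => φ (x + s • v)) t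
  have hprim (b : ℝ) : HasDerivAt (fun t => ∫ s in (0 : ℝ)..t, φ (x + s • v)) (φ (x + b • v)) b :=
    hcont.integral_hasStrictDerivAt 0 b |>.hasDerivAt
  have hderiv := ((hprim (1 + 0)).comp_const_add 1 0).fun_sub (hprim 0)
  refine HasLineDerivAt.lineDeriv ?_
  simpa [HasLineDerivAt, hshift] using hderiv

theorem lineDerivOp_apply_segmentAverage (f : 𝓓'((⊤ : Opens E), ℝ)) (v : E)
    (φ : 𝓓((⊤ : Opens E), ℝ)) :
    (∂_{v} f) (segmentAverage v φ) = f φ - f (translate v φ) := by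
  rw [Distribution.lineDerivOp_apply_apply, lineDerivOp_segmentAverage, map_neg, map_sub, neg_sub]

end SegmentIntegral

section FunctionDistribution

theorem integrable_test (φ : Test) (μ : Measure (ℝ × ℝ)) [IsFiniteMeasureOnCompacts μ] :
    Integrable φ μ :=
  φ.continuous.integrable_of_hasCompactSupport φ.hasCompactSupport

theorem integrable_toSignedMeasure (φ : Test) (μ : Measure (ℝ × ℝ)) [IsFiniteMeasure μ] :
    μ.toSignedMeasure.Integrable φ := by
  simpa [VectorMeasure.Integrable] using integrable_test φ μ

theorem integral_toSignedMeasure (φ : Test) (μ : Measure (ℝ × ℝ)) [IsFiniteMeasure μ] :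
    ∫ᵛ x, φ x ∂•μ.toSignedMeasure = ∫ x, φ x ∂μ := by
  have hflip : (ContinuousLinearMap.lsmul ℝ ℝ : ℝ →L[ℝ] ℝ →L[ℝ] ℝ) =
      (ContinuousLinearMap.lsmul ℝ ℝ : ℝ →L[ℝ] ℝ →L[ℝ] ℝ).flip := by ext; simp
  rw [hflip, VectorMeasure.integral_toSignedMeasure]

/-- The distribution `φ ↦ ∫ g φ`. This is `0` when `g` is not locally integrable. -/
def ofFun (g : ℝ × ℝ → ℝ) : Distr :=
  (TestFunction.integralAgainstBilinCLM (ContinuousLinearMap.mul ℝ ℝ) volume g : Test →L[ℝ] ℝ)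

theorem isFunction_ofFun {g : ℝ × ℝ → ℝ} (hg : LocallyIntegrable g) :
    IsFunction (ofFun g) g := by
  refine ⟨hg, fun φ => ?_⟩
  simp_rw [mul_comm (g _)]
  exact TestFunction.integralAgainstBilinCLM_eq_integral (𝕜 := ℝ)
    (B := ContinuousLinearMap.mul ℝ ℝ) (hg.locallyIntegrableOn (⊤ : Opens (ℝ × ℝ)))

theorem IsFunction.ae_eq {f : Distr} {g g' : ℝ × ℝ → ℝ} (h : IsFunction f g)
    (h' : IsFunction f g') : g =ᵐ[volume] g' := by
  refine ae_eq_of_integral_contDiff_smul_eq h.1 h'.1 fun u hu hc => ?_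
  simpa [mul_comm] using (h.2 (mkTest u hu hc)).symm.trans (h'.2 (mkTest u hu hc))

theorem IsFunction.eq {f f' : Distr} {g g' : ℝ × ℝ → ℝ} (h : IsFunction f g)
    (h' : IsFunction f' g') (hgg' : g =ᵐ[volume] g') : f = f' := by
  ext φ
  rw [h.2, h'.2]
  exact integral_congr_ae (hgg'.mono fun x hx => by simp only [hx])

theorem IsFunction.density {f : Distr} {g : ℝ × ℝ → ℝ} (h : IsFunction f g) :
    IsFunction f (density f) := by
  have hex : ∃ g, IsFunction f g := ⟨g, h⟩
  rw [MixedTV.density, dif_pos hex]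
  exact hex.choose_spec

theorem IsFunction.integrable_mul {f : Distr} {g : ℝ × ℝ → ℝ} (h : IsFunction f g) (φ : Test) :
    Integrable fun x => g x * φ x := by
  simpa [mul_comm] using
    h.1.integrable_smul_right_of_hasCompactSupport φ.continuous φ.hasCompactSupport

theorem IsFunction.ae_eq_zero_of_isVanishingOn {f : Distr} {g : ℝ × ℝ → ℝ} (h : IsFunction f g)
    {U : Set (ℝ × ℝ)} (hU : IsOpen U) (hf : Distribution.IsVanishingOn f U) :
    ∀ᵐ x, x ∈ U → g x = 0 := by
  refine hU.ae_eq_zero_of_integral_contDiff_smul_eq_zero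
    (h.1.locallyIntegrableOn _) fun u hu hc hsub => ?_
  simpa [mul_comm] using (h.2 (mkTest u hu hc)).symm.trans (hf _ hsub)

end FunctionDistribution

section DistributionFunction

section PartialOrder

variable {α : Type*} [PartialOrder α] [TopologicalSpace α] [OrderClosedTopology α]
  [SecondCountableTopology α] [MeasurableSpace α] [BorelSpace α]

theorem measurable_measureReal_Iic (μ : Measure α) [SFinite μ] :
    Measurable fun x => μ.real (Iic x) :=
  (measurable_measure_prodMk_right (μ := μ) measurableSet_le').ennreal_toReal

theorem integral_setIntegral_Ici (μ ν : Measure α) [IsFiniteMeasure μ] [SFinite ν] {φ : α → ℝ}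
    (hφ : Integrable φ ν) :
    ∫ s, ∫ x in Ici s, φ x ∂ν ∂μ = ∫ x, μ.real (Iic x) * φ x ∂ν := by
  let F : α × α → ℝ := {p | p.1 ≤ p.2}.indicator fun p => φ p.2
  have hF : Integrable F (μ.prod ν) := (hφ.comp_snd μ).indicator measurableSet_le'
  calc ∫ s, ∫ x in Ici s, φ x ∂ν ∂μ = ∫ s, ∫ x, F (s, x) ∂ν ∂μ := by
        simp_rw [← integral_indicator measurableSet_Ici]
        rfl
    _ = ∫ x, ∫ s, F (s, x) ∂μ ∂ν := integral_integral_swap hF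
    _ = ∫ x, μ.real (Iic x) * φ x ∂ν := integral_congr_ae <| .of_forall fun x => by
        change ∫ s, (Iic x).indicator (fun _ => φ x) s ∂μ = _
        rw [integral_indicator measurableSet_Iic, setIntegral_const, smul_eq_mul]

end PartialOrder

/-- The distribution function `x ↦ m (-∞, x]` of a signed measure on the plane, where
`(-∞, x]` is the lower-left quadrant with corner `x`. -/
def cdf (m : SignedMeasure (ℝ × ℝ)) (x : ℝ × ℝ) : ℝ := m (Iic x)

theorem cdf_eq_sub (m : SignedMeasure (ℝ × ℝ)) (x : ℝ × ℝ) :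
    cdf m x = m.toJordanDecomposition.posPart.real (Iic x) -
      m.toJordanDecomposition.negPart.real (Iic x) := by
  conv_lhs => rw [cdf, ← m.toSignedMeasure_toJordanDecomposition]
  simp [JordanDecomposition.toSignedMeasure]

theorem integral_eq_sub_jordanDecomposition (m : SignedMeasure (ℝ × ℝ)) (φ : Test) :
    ∫ᵛ x, φ x ∂•m = ∫ x, φ x ∂m.toJordanDecomposition.posPart -
      ∫ x, φ x ∂m.toJordanDecomposition.negPart := by
  conv_lhs => rw [← m.toSignedMeasure_toJordanDecomposition, JordanDecomposition.toSignedMeasure]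
  rw [VectorMeasure.integral_sub_vectorMeasure (integrable_toSignedMeasure φ _)
    (integrable_toSignedMeasure φ _), integral_toSignedMeasure, integral_toSignedMeasure]

theorem locallyIntegrable_measureReal_Iic (μ : Measure (ℝ × ℝ)) [IsFiniteMeasure μ] :
    LocallyIntegrable fun x => μ.real (Iic x) :=
  (locallyIntegrable_const (μ.real univ)).mono
    (measurable_measureReal_Iic μ).aestronglyMeasurable <| .of_forall fun x => by
      simpa [abs_of_nonneg] using measureReal_mono (μ := μ) (subset_univ (Iic x))

theorem exists_tsupport_subset_Iio (φ : Test) :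
    ∃ a : ℝ, 0 < a ∧ tsupport φ ⊆ Iio a ×ˢ Iio a := by
  obtain ⟨a, ha, hφ⟩ := φ.hasCompactSupport.isCompact.isBounded.subset_ball_lt 0 0
  refine ⟨a, ha, fun x hx => ?_⟩
  have hnorm := max_lt_iff.1 (mem_ball_zero_iff.1 (hφ hx))
  exact ⟨(le_abs_self _).trans_lt hnorm.1, (le_abs_self _).trans_lt hnorm.2⟩

theorem mul_segmentAverage_segmentAverage (φ : Test) {a : ℝ} (ha : 0 ≤ a) (s : ℝ × ℝ) :
    a * (a * segmentAverage (a, 0) (segmentAverage (0, a) φ) s) =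
      ∫ x in Icc s (s + (a, a)), φ x :=
  calc a * (a * segmentAverage (a, 0) (segmentAverage (0, a) φ) s)
      = a * ∫ t in (0 : ℝ)..1, a * ∫ u in (0 : ℝ)..1, φ (s.1 + a * t, s.2 + a * u) := by
        simp_rw [segmentAverage_apply, intervalIntegral.integral_const_mul]
        simp [Prod.add_def, mul_comm]
    _ = ∫ x in s.1..s.1 + a, ∫ y in s.2..s.2 + a, φ (x, y) := by
        have hinner (x : ℝ) := intervalIntegral.mul_integral_comp_add_mul (a := 0) (b := 1)
          (f := fun y => φ (x, y)) a s.2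
        have houter := intervalIntegral.mul_integral_comp_add_mul (a := 0) (b := 1)
          (f := fun x => ∫ y in s.2..s.2 + a, φ (x, y)) a s.1
        simpa only [hinner, mul_zero, mul_one, add_zero] using houter
    _ = ∫ x in Icc s (s + (a, a)), φ x := by
        rw [Icc_prod_eq, Measure.volume_eq_prod,
          setIntegral_prod _ (integrable_test φ _).integrableOn]
        simp_rw [intervalIntegral.integral_of_le (le_add_of_nonneg_right ha), Prod.fst_add,
          Prod.snd_add, integral_Icc_eq_integral_Ioc]

theorem setIntegral_Icc_add_eq_setIntegral_Ici {φ : Test} {a : ℝ}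
    (hφ : tsupport φ ⊆ Iio a ×ˢ Iio a) {s : ℝ × ℝ} (hs : 0 ≤ s) :
    ∫ x in Icc s (s + (a, a)), φ x = ∫ x in Ici s, φ x := by
  refine (setIntegral_eq_of_subset_of_forall_sdiff_eq_zero measurableSet_Ici Icc_subset_Ici_self
    fun x hx => ?_).symm
  by_contra hne
  have hlt := hφ (subset_tsupport φ hne)
  exact hx.2 ⟨hx.1, hlt.1.out.le.trans (le_add_of_nonneg_left hs.1),
    hlt.2.out.le.trans (le_add_of_nonneg_left hs.2)⟩

theorem integral_mul_segmentAverage_segmentAverage {μ : Measure (ℝ × ℝ)} [IsFiniteMeasure μ]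
    (hμ : μ (Ici 0)ᶜ = 0) (φ : Test) {a : ℝ} (ha : 0 < a) (hφ : tsupport φ ⊆ Iio a ×ˢ Iio a) :
    a * (a * ∫ s, segmentAverage (a, 0) (segmentAverage (0, a) φ) s ∂μ) =
      ∫ x, μ.real (Iic x) * φ x := by
  rw [← integral_setIntegral_Ici μ volume (integrable_test φ _), ← integral_const_mul,
    ← integral_const_mul]
  refine integral_congr_ae ?_
  filter_upwards [mem_ae_iff.2 hμ] with s hs
  exact (mul_segmentAverage_segmentAverage φ ha.le s).trans
    (setIntegral_Icc_add_eq_setIntegral_Ici hφ hs)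

theorem apply_translate_eq_zero {f : Distr} (hf : Distribution.IsVanishingOn f (Ici 0)ᶜ)
    {φ : Test} {a : ℝ} (hφ : tsupport φ ⊆ Iio a ×ˢ Iio a) {v : ℝ × ℝ} (hv : a ≤ v.1 ∨ a ≤ v.2) :
    f (translate v φ) = 0 := by
  refine hf _ fun x hx (hx₀ : 0 ≤ x) => ?_
  have hx₁ : 0 ≤ x.1 := hx₀.1
  have hx₂ : 0 ≤ x.2 := hx₀.2
  obtain ⟨hlt₁ : x.1 + v.1 < a, hlt₂ : x.2 + v.2 < a⟩ := hφ ((tsupport_translate v φ).subset hx)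
  rcases hv with hv | hv <;> linarith

theorem apply_eq_mul_D₁₂_apply {f : Distr} (hf : Distribution.IsVanishingOn f (Ici 0)ᶜ)
    (φ : Test) {a : ℝ} (hφ : tsupport φ ⊆ Iio a ×ˢ Iio a) :
    f φ = a * (a * D₁₂ f (segmentAverage (a, 0) (segmentAverage (0, a) φ))) := by
  have hscale : ∂_{((a, 0) : ℝ × ℝ)} (∂_{((0, a) : ℝ × ℝ)} f) = a • a • D₁₂ f := by
    rw [D₁₂, D₁, D₂, ← LineDeriv.lineDerivOp_smul, ← LineDeriv.lineDerivOp_left_smul,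
      ← LineDeriv.lineDerivOp_left_smul]
    simp
  calc f φ = (∂_{((a, 0) : ℝ × ℝ)} (∂_{((0, a) : ℝ × ℝ)} f))
        (segmentAverage (a, 0) (segmentAverage (0, a) φ)) := by
        rw [lineDerivOp_apply_segmentAverage, translate_segmentAverage,
          lineDerivOp_apply_segmentAverage, lineDerivOp_apply_segmentAverage, translate_translate,
          apply_translate_eq_zero hf hφ (.inr le_rfl), apply_translate_eq_zero hf hφ (.inl le_rfl),
          apply_translate_eq_zero hf hφ (by simp)]
        ring
    _ = a * (a * D₁₂ f (segmentAverage (a, 0) (segmentAverage (0, a) φ))) := by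
        simp only [hscale, smul_apply, smul_eq_mul]

theorem isFunction_cdf {f : Distr} (hf : Distribution.IsVanishingOn f (Ici 0)ᶜ)
    {m : SignedMeasure (ℝ × ℝ)} (hm : IsMeasure (D₁₂ f) m) (hm₀ : m.variation (Ici 0)ᶜ = 0) :
    IsFunction f (cdf m) := by
  set μ := m.toJordanDecomposition.posPart
  set ν := m.toJordanDecomposition.negPart
  have hμν : μ (Ici 0)ᶜ + ν (Ici 0)ᶜ = 0 := by
    rw [← hm₀, ← m.totalVariation_eq_variation]
    rfl
  have hcdf : cdf m = fun x => μ.real (Iic x) - ν.real (Iic x) := funext (cdf_eq_sub m)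
  have hμ := locallyIntegrable_measureReal_Iic μ
  have hν := locallyIntegrable_measureReal_Iic ν
  refine ⟨hcdf ▸ hμ.sub hν, fun φ => ?_⟩
  obtain ⟨a, ha, hφ⟩ := exists_tsupport_subset_Iio φ
  rw [apply_eq_mul_D₁₂_apply hf φ hφ, hm, integral_eq_sub_jordanDecomposition, mul_sub, mul_sub,
    integral_mul_segmentAverage_segmentAverage (add_eq_zero.1 hμν).1 φ ha hφ,
    integral_mul_segmentAverage_segmentAverage (add_eq_zero.1 hμν).2 φ ha hφ,
    ← integral_sub ((isFunction_ofFun hμ).integrable_mul φ)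
      ((isFunction_ofFun hν).integrable_mul φ), hcdf]
  simp_rw [sub_mul]

end DistributionFunction

section TotalVariation

theorem enorm_apply_le_variation {T : Distr} {m : SignedMeasure (ℝ × ℝ)} (hm : IsMeasure T m)
    {φ : Test} (hφ : ∀ x, |φ x| ≤ 1) : ‖T φ‖ₑ ≤ m.variation univ := by
  have hφ' (x : ℝ × ℝ) : ‖φ x‖ₑ ≤ 1 := by
    rw [Real.enorm_eq_ofReal_abs]
    exact ENNReal.ofReal_le_one.2 (hφ x)
  have hlsmul : ‖(ContinuousLinearMap.lsmul ℝ ℝ : ℝ →L[ℝ] ℝ →L[ℝ] ℝ)‖ₑ ≤ 1 := by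
    rw [← enorm_one (G := ℝ), enorm_le_iff_norm_le, norm_one]
    exact ContinuousLinearMap.opNorm_lsmul_le
  calc ‖T φ‖ₑ = ‖∫ᵛ x, φ x ∂•m‖ₑ := by rw [hm]
    _ ≤ 1 * ‖(ContinuousLinearMap.lsmul ℝ ℝ : ℝ →L[ℝ] ℝ →L[ℝ] ℝ)‖ₑ * m.variation univ :=
        VectorMeasure.enorm_integral_le_of_enorm_le_const (.of_forall hφ')
    _ ≤ m.variation univ := by
        rw [one_mul]
        exact mul_le_of_le_one_left' hlsmul

theorem sum_abs_apply_le_normM (T : Distr) {ι : Type*} {s : Finset ι} {ψ : ι → Test}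
    (hψ₀ : ∀ p x, 0 ≤ ψ p x) (hψ₁ : ∀ x, ∑ p ∈ s, ψ p x ≤ 1) :
    ENNReal.ofReal (∑ p ∈ s, |T (ψ p)|) ≤ normM T := by
  let φ : Test := ∑ p ∈ s, (SignType.sign (T (ψ p)) : ℝ) • ψ p
  have hTφ : ∑ p ∈ s, |T (ψ p)| = T φ := by
    simp only [φ, map_sum, map_smul, smul_eq_mul, sign_mul_self]
  have hφ (x : ℝ × ℝ) : |φ x| ≤ 1 := calc
    |φ x| = |∑ p ∈ s, (SignType.sign (T (ψ p)) : ℝ) * ψ p x| := by simp [φ]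
    _ ≤ ∑ p ∈ s, ψ p x := (Finset.abs_sum_le_sum_abs _ _).trans <| Finset.sum_le_sum fun p _ => by
        rw [abs_mul, abs_of_nonneg (hψ₀ p x)]
        refine mul_le_of_le_one_left (hψ₀ p x) ?_
        rcases SignType.sign (T (ψ p)) with _ | _ | _ <;> simp
    _ ≤ 1 := hψ₁ x
  rw [hTφ]
  exact le_iInf₂ fun m hm =>
    (Real.ofReal_le_enorm _).trans (enorm_apply_le_variation hm hφ)

theorem sum_abs_le_normM_of_tendsto {T : Distr} {ι : Type*} {s : Finset ι} {ψ : ℕ → ι → Test}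
    (hψ₀ : ∀ k p x, 0 ≤ ψ k p x) (hψ₁ : ∀ k x, ∑ p ∈ s, ψ k p x ≤ 1) {L : ι → ℝ}
    (hL : ∀ p, Tendsto (fun k => T (ψ k p)) atTop (𝓝 (L p))) :
    ENNReal.ofReal (∑ p ∈ s, |L p|) ≤ normM T :=
  le_of_tendsto (ENNReal.continuous_ofReal.continuousAt.tendsto.comp
    (tendsto_finsetSum s fun p _ => (hL p).abs))
    (.of_forall fun k => sum_abs_apply_le_normM T (hψ₀ k) (hψ₁ k))

theorem exists_isMeasure_of_sum {T : Distr} {ι : Type*} (s : Finset ι) (a : ι → ℝ)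
    (μ : ι → Measure (ℝ × ℝ)) [∀ p, IsFiniteMeasure (μ p)]
    (hT : ∀ φ : Test, T φ = ∑ p ∈ s, a p * ∫ x, φ x ∂μ p) :
    ∃ m : SignedMeasure (ℝ × ℝ), IsMeasure T m ∧
      ∀ A, m.variation A ≤ ∑ p ∈ s, ‖a p‖ₑ * μ p A := by
  refine ⟨∑ p ∈ s, a p • (μ p).toSignedMeasure, fun φ => ?_, fun A => ?_⟩
  · rw [hT, VectorMeasure.integral_finsetSum_vectorMeasure fun p _ =>
      (integrable_toSignedMeasure φ (μ p)).smul_vectorMeasure _]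
    refine Finset.sum_congr rfl fun p _ => ?_
    rw [VectorMeasure.integral_smul_vectorMeasure, integral_toSignedMeasure, smul_eq_mul]
  · refine (VectorMeasure.variation_finsetSum_le s _ A).trans ?_
    rw [Measure.finsetSum_apply]
    refine Finset.sum_le_sum fun p _ => ?_
    rw [VectorMeasure.variation_smul, Measure.variation_toSignedMeasure]
    simp [enorm_eq_nnnorm]

theorem normM_le_sum_abs {T : Distr} {ι : Type*} (s : Finset ι) (a : ι → ℝ)
    (μ : ι → Measure (ℝ × ℝ)) [∀ p, IsProbabilityMeasure (μ p)]
    (hT : ∀ φ : Test, T φ = ∑ p ∈ s, a p * ∫ x, φ x ∂μ p) :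
    normM T ≤ ENNReal.ofReal (∑ p ∈ s, |a p|) := by
  obtain ⟨m, hm, hvariation⟩ := exists_isMeasure_of_sum s a μ hT
  calc normM T ≤ m.variation univ := iInf₂_le m hm
    _ ≤ ∑ p ∈ s, ‖a p‖ₑ * μ p univ := hvariation univ
    _ = ENNReal.ofReal (∑ p ∈ s, |a p|) := by
        simp_rw [measure_univ, mul_one, Real.enorm_eq_ofReal_abs]
        exact (ENNReal.ofReal_sum_of_nonneg fun p _ => abs_nonneg _).symm

end TotalVariation

section IndicatorApproximation

variable {E : Type*} [NormedAddCommGroup E] [NormedSpace ℝ E]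

/-- The test functions `ψ k` approximate the indicator function of `U` pointwise from below. -/
structure ApproximatesIndicator (ψ : ℕ → 𝓓((⊤ : Opens E), ℝ)) (U : Set E) : Prop where
  nonneg : ∀ k x, 0 ≤ ψ k x
  le_indicator : ∀ k x, ψ k x ≤ U.indicator 1 x
  tendsto : ∀ x, Tendsto (fun k => ψ k x) atTop (𝓝 (U.indicator 1 x))

theorem ApproximatesIndicator.translate {ψ : ℕ → 𝓓((⊤ : Opens E), ℝ)} {U : Set E}
    (hψ : ApproximatesIndicator ψ U) (v : E) :
    ApproximatesIndicator (fun k => translate v (ψ k)) ((· + v) ⁻¹' U) where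
  nonneg k x := hψ.nonneg k (x + v)
  le_indicator k x := hψ.le_indicator k (x + v)
  tendsto x := hψ.tendsto (x + v)

theorem tendsto_smoothTransition_natCast_mul {t : ℝ} (ht : 0 < t) :
    Tendsto (fun k : ℕ => Real.smoothTransition (k * t)) atTop (𝓝 1) := by
  refine tendsto_const_nhds.congr' ?_
  filter_upwards [(tendsto_natCast_atTop_atTop.atTop_mul_const ht).eventually_ge_atTop 1]
    with k hk using (Real.smoothTransition.one_of_one_le hk).symm

theorem exists_approximatesIndicator [FiniteDimensional ℝ E] {U : Set E} (hU : IsOpen U)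
    (hbounded : Bornology.IsBounded U) :
    ∃ ψ : ℕ → 𝓓((⊤ : Opens E), ℝ), ApproximatesIndicator ψ U := by
  obtain ⟨u, hsupport, hu, hrange⟩ := hU.exists_contDiff_support_eq (n := ⊤)
  have hu₀ (x : E) : 0 ≤ u x := (hrange (mem_range_self x)).1
  have hzero {x : E} (hx : x ∉ U) : u x = 0 := by rwa [← hsupport, Function.notMem_support] at hx
  have hpos {x : E} (hx : x ∈ U) : 0 < u x := by
    rw [← hsupport] at hx
    exact (hu₀ x).lt_of_ne' hx
  have hcompact (k : ℕ) : HasCompactSupport fun x => Real.smoothTransition (k * u x) :=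
    .intro hbounded.isCompact_closure fun x hx => by
      rw [hzero fun hxU => hx (subset_closure hxU), mul_zero, Real.smoothTransition.zero]
  let ψ (k : ℕ) : 𝓓((⊤ : Opens E), ℝ) :=
    mkTest (fun x => Real.smoothTransition (k * u x))
      ((Real.smoothTransition.contDiff (n := ⊤)).comp (contDiff_const.mul hu)) (hcompact k)
  refine ⟨ψ, fun k x => Real.smoothTransition.nonneg _, fun k x => ?_, fun x => ?_⟩ <;>
    by_cases hx : x ∈ U
  · simpa [ψ, hx] using Real.smoothTransition.le_one _
  · simp [ψ, hx, hzero hx]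
  · simpa [ψ, hx] using tendsto_smoothTransition_natCast_mul (hpos hx)
  · simp [ψ, hx, hzero hx]

theorem IsFunction.tendsto_apply {f : Distr} {g : ℝ × ℝ → ℝ} (h : IsFunction f g)
    {ψ : ℕ → Test} {U : Set (ℝ × ℝ)} (hψ : ApproximatesIndicator ψ U) (hU : MeasurableSet U)
    (hg : IntegrableOn g U) : Tendsto (fun k => f (ψ k)) atTop (𝓝 (∫ x in U, g x)) := by
  simp_rw [h.2]
  rw [← integral_indicator hU]
  refine tendsto_integral_of_dominated_convergence (fun x => ‖U.indicator g x‖)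
    (fun k => (h.integrable_mul (ψ k)).aestronglyMeasurable) (hg.integrable_indicator hU).norm
    (fun k => .of_forall fun x => ?_) (.of_forall fun x => ?_)
  · have hle : ‖g x * ψ k x‖ ≤ ‖g x‖ * U.indicator 1 x := by
      rw [norm_mul, Real.norm_of_nonneg (hψ.nonneg k x)]
      gcongr
      exact hψ.le_indicator k x
    by_cases hx : x ∈ U <;> simpa [hx] using hle
  · have hlim := (hψ.tendsto x).const_mul (g x)
    by_cases hx : x ∈ U <;> simpa [hx] using hlim

end IndicatorApproximation

section Grid

/-- The point `p / n` of the square lattice of mesh `1 / n`. -/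
def knot (n : ℕ) (p : ℤ × ℤ) : ℝ × ℝ := (p.1 / n, p.2 / n)

theorem knot_add (n : ℕ) (p q : ℤ × ℤ) : knot n (p + q) = knot n p + knot n q := by
  simp [knot, add_div]

theorem knot_sub (n : ℕ) (p q : ℤ × ℤ) : knot n (p - q) = knot n p - knot n q := by
  simp [knot, sub_div]

theorem knot_add_one (n : ℕ) (p : ℤ × ℤ) : knot n (p + 1) = knot n p + ((n : ℝ)⁻¹, (n : ℝ)⁻¹) := by
  rw [knot_add]
  simp [knot]

/-- The backward difference of `c` in the direction `e`. -/
def diff (e : ℤ × ℤ) (c : ℤ × ℤ → ℝ) (p : ℤ × ℤ) : ℝ := c p - c (p - e)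

theorem sum_mul_sub_eq_neg_sum_diff_mul {S : Finset (ℤ × ℤ)} {c : ℤ × ℤ → ℝ} {e : ℤ × ℤ}
    (hS : ∀ p, c p ≠ 0 → p ∈ S ∧ p + e ∈ S) (b : ℤ × ℤ → ℝ) :
    ∑ p ∈ S, c p * (b (p + e) - b p) = -∑ p ∈ S, diff e c p * b p := by
  have hshift : ∑ p ∈ S, c p * b (p + e) = ∑ p ∈ S, c (p - e) * b p := by
    refine Finset.sum_bij_ne_zero (fun p _ _ => p + e)
      (fun p _ h => (hS p (left_ne_zero_of_mul h)).2)
      (fun p _ _ q _ _ h => add_right_cancel h) (fun q _ h => ?_) (fun p _ _ => by simp)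
    exact ⟨q - e, (hS _ (left_ne_zero_of_mul h)).1, by simpa using h, by simp⟩
  simp only [diff, mul_sub, sub_mul, Finset.sum_sub_distrib, hshift, neg_sub]

theorem translate_knot_translate_neg_knot (n : ℕ) (e p : ℤ × ℤ) (φ : Test) :
    translate (knot n e) (translate (-knot n p) φ) = translate (-knot n (p - e)) φ := by
  rw [translate_translate, knot_sub, neg_sub, sub_eq_add_neg]

/-- The indices of the cells that make up the half-open unit square. -/
def pixelIndex (n : ℕ) : Finset (ℤ × ℤ) := Finset.Ico 0 (n : ℤ) ×ˢ Finset.Ico 0 (n : ℤ)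

/-- The indices of the lattice points in the unit square. -/
def knotIndex (n : ℕ) : Finset (ℤ × ℤ) := Finset.Icc 0 (n : ℤ) ×ˢ Finset.Icc 0 (n : ℤ)

theorem add_mem_knotIndex {n : ℕ} {p e : ℤ × ℤ} (hp : p ∈ pixelIndex n) (he : e ∈ Icc 0 1) :
    p + e ∈ knotIndex n := by
  simp only [pixelIndex, knotIndex, Finset.mem_product, Finset.mem_Ico, Finset.mem_Icc, mem_Icc,
    Prod.le_def, Prod.fst_add, Prod.snd_add, Prod.fst_zero, Prod.snd_zero, Prod.fst_one,
    Prod.snd_one] at *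
  lia

theorem add_mem_knotIndex_of_ne_zero {n : ℕ} {c : ℤ × ℤ → ℝ} (hc : ∀ p ∉ pixelIndex n, c p = 0)
    {p : ℤ × ℤ} (hp : c p ≠ 0) {e : ℤ × ℤ} (he : e ∈ Icc 0 1) : p + e ∈ knotIndex n :=
  add_mem_knotIndex (not_imp_comm.1 (hc p) hp) he

theorem mem_knotIndex_of_ne_zero {n : ℕ} {c : ℤ × ℤ → ℝ} (hc : ∀ p ∉ pixelIndex n, c p = 0)
    {p : ℤ × ℤ} (hp : c p ≠ 0) : p ∈ knotIndex n := by
  simpa using add_mem_knotIndex_of_ne_zero hc hp (e := 0) (by simp)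

/-- The index of the cell of mesh `1 / n` that contains `x`. -/
def cellIndex (n : ℕ) (x : ℝ × ℝ) : ℤ × ℤ := (⌊n * x.1⌋, ⌊n * x.2⌋)

/-- The half-open cell of mesh `1 / n` with lower-left corner `knot n p`. -/
def cell (n : ℕ) (p : ℤ × ℤ) : Set (ℝ × ℝ) := cellIndex n ⁻¹' {p}

variable {n : ℕ} [NeZero n]

theorem cellIndex_sub_knot (x : ℝ × ℝ) (p : ℤ × ℤ) :
    cellIndex n (x - knot n p) = cellIndex n x - p := by
  have hn : (n : ℝ) ≠ 0 := NeZero.ne _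
  ext <;> simp [cellIndex, knot, mul_sub, mul_div_cancel₀ _ hn]

theorem preimage_sub_knot_cell (p : ℤ × ℤ) : (· - knot n p) ⁻¹' cell n 0 = cell n p := by
  ext x
  simp [cell, cellIndex_sub_knot, sub_eq_zero]

theorem cellIndex_mem_pixelIndex {x : ℝ × ℝ} :
    cellIndex n x ∈ pixelIndex n ↔ x ∈ Ico (0 : ℝ) 1 ×ˢ Ico (0 : ℝ) 1 := by
  have hn : (0 : ℝ) < n := Nat.cast_pos.2 (NeZero.pos n)
  simp [pixelIndex, cellIndex, Int.floor_nonneg, Int.floor_lt, mul_nonneg_iff_of_pos_left hn,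
    mul_lt_iff_lt_one_right hn]

theorem cell_eq_Ico_prod_Ico (p : ℤ × ℤ) : cell n p =
    Ico (knot n p).1 (knot n (p + 1)).1 ×ˢ Ico (knot n p).2 (knot n (p + 1)).2 := by
  have hn : (0 : ℝ) < n := Nat.cast_pos.2 (NeZero.pos n)
  ext x
  simp [cell, cellIndex, knot, Prod.ext_iff, Int.floor_eq_iff, div_le_iff₀ hn, lt_div_iff₀ hn,
    mul_comm]

theorem interior_cell_ae_eq (p : ℤ × ℤ) : interior (cell n p) =ᵐ[volume] cell n p := by
  rw [cell_eq_Ico_prod_Ico, interior_prod_eq, interior_Ico, interior_Ico]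
  exact Measure.set_prod_ae_eq Ioo_ae_eq_Ico Ioo_ae_eq_Ico

theorem cell_ae_eq_Icc (p : ℤ × ℤ) : cell n p =ᵐ[volume] Icc (knot n p) (knot n (p + 1)) := by
  rw [cell_eq_Ico_prod_Ico, Icc_prod_eq]
  exact Measure.set_prod_ae_eq Ico_ae_eq_Icc Ico_ae_eq_Icc

theorem measurableSet_cell (p : ℤ × ℤ) : MeasurableSet (cell n p) := by
  rw [cell_eq_Ico_prod_Ico]
  exact measurableSet_Ico.prod measurableSet_Ico

theorem isBounded_cell (p : ℤ × ℤ) : Bornology.IsBounded (cell n p) := by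
  rw [cell_eq_Ico_prod_Ico]
  exact (Metric.isBounded_Ico _ _).prod (Metric.isBounded_Ico _ _)

/-- The integral of `g` over the cell with index `p`. -/
def cellIntegral (n : ℕ) (g : ℝ × ℝ → ℝ) (p : ℤ × ℤ) : ℝ := ∫ x in cell n p, g x

theorem IsFunction.integrableOn_cell {f : Distr} {g : ℝ × ℝ → ℝ} (h : IsFunction f g)
    (p : ℤ × ℤ) : IntegrableOn g (cell n p) :=
  (h.1.integrableOn_isCompact (isBounded_cell p).isCompact_closure).mono_set subset_closure

theorem IsFunction.tendsto_apply_translate {f : Distr} {g : ℝ × ℝ → ℝ} (h : IsFunction f g)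
    {ψ : ℕ → Test} (hψ : ApproximatesIndicator ψ (interior (cell n 0))) (p : ℤ × ℤ) :
    Tendsto (fun k => f (translate (-knot n p) (ψ k))) atTop (𝓝 (cellIntegral n g p)) := by
  have hpreimage : (· + -knot n p) ⁻¹' interior (cell n 0) = interior (cell n p) := by
    rw [← preimage_sub_knot_cell p]
    simp_rw [← sub_eq_add_neg]
    exact (Homeomorph.subRight (knot n p)).preimage_interior _
  rw [cellIntegral, ← setIntegral_congr_set (interior_cell_ae_eq p), ← hpreimage]
  refine h.tendsto_apply (hψ.translate _) ?_ ?_ <;> rw [hpreimage]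
  · exact isOpen_interior.measurableSet
  · exact (h.integrableOn_cell p).mono_set interior_subset

theorem sum_translate_neg_knot_le_one {ψ : Test}
    (hψ : ∀ x, ψ x ≤ (interior (cell n 0)).indicator 1 x) (S : Finset (ℤ × ℤ)) (x : ℝ × ℝ) :
    ∑ p ∈ S, translate (-knot n p) ψ x ≤ 1 := by
  calc ∑ p ∈ S, translate (-knot n p) ψ x ≤ ∑ p ∈ S, if cellIndex n x = p then (1 : ℝ) else 0 := by
        refine Finset.sum_le_sum fun p _ => (hψ _).trans ?_
        refine (indicator_le_indicator_of_subset interior_subset (fun _ => zero_le_one) _).trans ?_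
        simp [indicator, cell, ← sub_eq_add_neg, cellIndex_sub_knot, sub_eq_zero]
    _ ≤ 1 := by
        rw [Finset.sum_ite_eq]
        split_ifs <;> simp

theorem exists_approximatesIndicator_interior_cell :
    ∃ ψ : ℕ → Test, ApproximatesIndicator ψ (interior (cell n 0)) :=
  exists_approximatesIndicator isOpen_interior ((isBounded_cell 0).subset interior_subset)

variable (n) in
theorem IsFunction.sum_abs_diff_le_normM {f : Distr} {g : ℝ × ℝ → ℝ} (h : IsFunction f g)
    (a : ℝ) (e : ℤ × ℤ) (S : Finset (ℤ × ℤ)) :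
    ENNReal.ofReal (∑ p ∈ S, |a * diff e (cellIntegral n g) p|) ≤
      normM (a • ∂_{knot n e} f) := by
  obtain ⟨ψ, hψ⟩ := exists_approximatesIndicator_interior_cell (n := n)
  refine sum_abs_le_normM_of_tendsto
    (ψ := fun k p => segmentAverage (knot n e) (translate (-knot n p) (ψ k)))
    (fun k p => segmentAverage_nonneg _ fun x => hψ.nonneg k _)
    (fun k => sum_segmentAverage_le_one
      (sum_translate_neg_knot_le_one (hψ.le_indicator k) S) _) fun p => ?_
  simp_rw [smul_apply, smul_eq_mul]
  simp_rw [lineDerivOp_apply_segmentAverage, translate_knot_translate_neg_knot]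
  exact ((h.tendsto_apply_translate hψ p).sub (h.tendsto_apply_translate hψ (p - e))).const_mul a

variable (n) in
theorem IsFunction.sum_abs_diff_diff_le_normM {f : Distr} {g : ℝ × ℝ → ℝ} (h : IsFunction f g)
    (a : ℝ) (e e' : ℤ × ℤ) (S : Finset (ℤ × ℤ)) :
    ENNReal.ofReal (∑ p ∈ S, |a * diff e (diff e' (cellIntegral n g)) p|) ≤
      normM (a • ∂_{knot n e} (∂_{knot n e'} f)) := by
  obtain ⟨ψ, hψ⟩ := exists_approximatesIndicator_interior_cell (n := n)
  refine sum_abs_le_normM_of_tendsto (ψ := fun k p =>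
      segmentAverage (knot n e) (segmentAverage (knot n e') (translate (-knot n p) (ψ k))))
    (fun k p => segmentAverage_nonneg _ <| segmentAverage_nonneg _ fun x => hψ.nonneg k _)
    (fun k => sum_segmentAverage_le_one (sum_segmentAverage_le_one
      (sum_translate_neg_knot_le_one (hψ.le_indicator k) S) _) _) fun p => ?_
  simp_rw [smul_apply, smul_eq_mul]
  simp_rw [lineDerivOp_apply_segmentAverage, translate_segmentAverage,
    lineDerivOp_apply_segmentAverage, translate_knot_translate_neg_knot]
  have hlim (q : ℤ × ℤ) :=
    (h.tendsto_apply_translate hψ q).sub (h.tendsto_apply_translate hψ (q - e'))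
  exact ((hlim p).sub (hlim (p - e))).const_mul a

theorem smul_lineDerivOp_knot (f : Distr) (e : ℤ × ℤ) :
    (n : ℝ) • ∂_{knot n e} f = ∂_{((e.1, e.2) : ℝ × ℝ)} f := by
  have hn : (n : ℝ) ≠ 0 := NeZero.ne _
  rw [← LineDeriv.lineDerivOp_left_smul]
  simp [knot, mul_div_cancel₀ _ hn]

theorem D₁_eq_smul_lineDerivOp_knot (n : ℕ) [NeZero n] (f : Distr) :
    D₁ f = (n : ℝ) • ∂_{knot n (1, 0)} f := by
  simp [smul_lineDerivOp_knot, D₁]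

theorem D₂_eq_smul_lineDerivOp_knot (n : ℕ) [NeZero n] (f : Distr) :
    D₂ f = (n : ℝ) • ∂_{knot n (0, 1)} f := by
  simp [smul_lineDerivOp_knot, D₂]

theorem D₁₂_eq_smul_lineDerivOp_knot (n : ℕ) [NeZero n] (f : Distr) :
    D₁₂ f = (n ^ 2 : ℝ) • ∂_{knot n (1, 0)} (∂_{knot n (0, 1)} f) := by
  rw [D₁₂, D₁_eq_smul_lineDerivOp_knot n, D₂_eq_smul_lineDerivOp_knot n,
    LineDeriv.lineDerivOp_smul, smul_smul, sq]

end Grid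

section StepDistribution

/-- The step function that is constant on each cell and whose integral over the cell with
index `p` is `c p`. -/
def stepFunction (n : ℕ) (c : ℤ × ℤ → ℝ) (x : ℝ × ℝ) : ℝ := n ^ 2 * c (cellIndex n x)

/-- The step function `stepFunction n c` as a distribution. -/
def stepDistr (n : ℕ) (c : ℤ × ℤ → ℝ) : Distr := ofFun (stepFunction n c)

theorem stepFunction_mul_eq_sum_indicator {n : ℕ} {S : Finset (ℤ × ℤ)} {c : ℤ × ℤ → ℝ}
    (hc : ∀ p ∉ S, c p = 0) (φ : ℝ × ℝ → ℝ) (x : ℝ × ℝ) :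
    stepFunction n c x * φ x = ∑ p ∈ S, (cell n p).indicator (fun x => n ^ 2 * c p * φ x) x := by
  simp only [indicator, cell, mem_preimage, mem_singleton_iff, Finset.sum_ite_eq]
  split_ifs with h
  · rfl
  · rw [stepFunction, hc _ h, mul_zero, zero_mul]

theorem mem_knotIndex_of_diff_ne_zero {n : ℕ} {c : ℤ × ℤ → ℝ}
    (hc : ∀ p ∉ pixelIndex n, c p = 0) {p : ℤ × ℤ} (hp : diff (0, 1) c p ≠ 0) :
    p ∈ knotIndex n ∧ p + (1, 0) ∈ knotIndex n := by
  obtain h | h : c p ≠ 0 ∨ c (p - (0, 1)) ≠ 0 := by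
    contrapose! hp
    rw [diff, hp.1, hp.2, sub_zero]
  · exact ⟨mem_knotIndex_of_ne_zero hc h,
      add_mem_knotIndex_of_ne_zero hc h (by simp [Prod.le_def])⟩
  · have hshift : p - (0, 1) + (1, 1) = p + (1, 0) := by ext <;> simp
    exact ⟨by simpa using add_mem_knotIndex_of_ne_zero hc h (e := (0, 1)) (by simp [Prod.le_def]),
      hshift ▸ add_mem_knotIndex_of_ne_zero hc h (by simp [Prod.le_def])⟩

theorem sum_mul_translate_sub {n : ℕ} {c : ℤ × ℤ → ℝ} {e : ℤ × ℤ}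
    (hc : ∀ p, c p ≠ 0 → p ∈ knotIndex n ∧ p + e ∈ knotIndex n) (φ : Test) :
    ∑ p ∈ knotIndex n, c p * (translate (knot n e) φ - φ) (knot n p) =
      -∑ p ∈ knotIndex n, diff e c p * φ (knot n p) := by
  rw [← sum_mul_sub_eq_neg_sum_diff_mul hc]
  simp [knot_add]

variable {n : ℕ} [NeZero n]

theorem locallyIntegrable_stepFunction {S : Finset (ℤ × ℤ)} {c : ℤ × ℤ → ℝ}
    (hc : ∀ p ∉ S, c p = 0) : LocallyIntegrable (stepFunction n c) := by
  have hsum : stepFunction n c =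
      fun x => ∑ p ∈ S, (cell n p).indicator (fun _ => n ^ 2 * c p) x := by
    ext x
    simpa using stepFunction_mul_eq_sum_indicator hc (fun _ => 1) x
  rw [hsum]
  exact (integrable_finsetSum S fun p _ =>
    (integrableOn_const (isBounded_cell p).measure_lt_top.ne).integrable_indicator
      (measurableSet_cell p)).locallyIntegrable

theorem isFunction_stepDistr {S : Finset (ℤ × ℤ)} {c : ℤ × ℤ → ℝ} (hc : ∀ p ∉ S, c p = 0) :
    IsFunction (stepDistr n c) (stepFunction n c) :=
  isFunction_ofFun (locallyIntegrable_stepFunction hc)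

theorem sq_mul_setIntegral_cell (p : ℤ × ℤ) (φ : Test) : n ^ 2 * ∫ x in cell n p, φ x =
    segmentAverage (knot n (1, 0)) (segmentAverage (knot n (0, 1)) φ) (knot n p) := by
  have hn : (n : ℝ) ≠ 0 := NeZero.ne _
  rw [setIntegral_congr_set (cell_ae_eq_Icc p), knot_add_one,
    ← mul_segmentAverage_segmentAverage φ (by positivity)]
  simp only [knot, Int.cast_one, Int.cast_zero, one_div, zero_div]
  field_simp

theorem stepDistr_apply {S : Finset (ℤ × ℤ)} {c : ℤ × ℤ → ℝ} (hc : ∀ p ∉ S, c p = 0)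
    (φ : Test) : stepDistr n c φ = ∑ p ∈ S, c p *
      segmentAverage (knot n (1, 0)) (segmentAverage (knot n (0, 1)) φ) (knot n p) := by
  rw [(isFunction_stepDistr hc).2]
  simp_rw [stepFunction_mul_eq_sum_indicator hc, ← sq_mul_setIntegral_cell]
  rw [integral_finsetSum _ fun p _ =>
    (((integrable_test φ _).const_mul _).integrableOn.integrable_indicator (measurableSet_cell p))]
  refine Finset.sum_congr rfl fun p _ => ?_
  rw [integral_indicator (measurableSet_cell p), integral_const_mul]
  ring

theorem cellIntegral_stepFunction (c : ℤ × ℤ → ℝ) : cellIntegral n (stepFunction n c) = c := by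
  have hn : (0 : ℝ) < n := Nat.cast_pos.2 (NeZero.pos n)
  ext p
  have hconst : EqOn (stepFunction n c) (fun _ => n ^ 2 * c p) (cell n p) := fun x hx => by
    rw [stepFunction, hx.out]
  have hvolume : volume.real (cell n p) = (n : ℝ)⁻¹ * (n : ℝ)⁻¹ := by
    rw [measureReal_congr (cell_ae_eq_Icc p), knot_add_one, Icc_prod_eq, Measure.volume_eq_prod,
      measureReal_prod_prod]
    simp
  rw [cellIntegral, setIntegral_congr_fun (measurableSet_cell p) hconst, setIntegral_const,
    hvolume, smul_eq_mul]
  field_simp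

theorem stepDistr_apply_eq_sum_knotIndex {c : ℤ × ℤ → ℝ} (hc : ∀ p ∉ pixelIndex n, c p = 0)
    (φ : Test) : stepDistr n c φ = ∑ p ∈ knotIndex n, c p *
      segmentAverage (knot n (1, 0)) (segmentAverage (knot n (0, 1)) φ) (knot n p) :=
  stepDistr_apply (fun _ hp => by_contra fun h => hp (mem_knotIndex_of_ne_zero hc h)) φ

theorem lineDerivOp_stepDistr_apply₁ {c : ℤ × ℤ → ℝ} (hc : ∀ p ∉ pixelIndex n, c p = 0)
    (φ : Test) : (∂_{knot n (1, 0)} (stepDistr n c)) φ =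
      ∑ p ∈ knotIndex n, diff (1, 0) c p * segmentAverage (knot n (0, 1)) φ (knot n p) := by
  rw [Distribution.lineDerivOp_apply_apply, map_neg, stepDistr_apply_eq_sum_knotIndex hc]
  simp_rw [segmentAverage_comm (knot n (1, 0)), segmentAverage_lineDerivOp, segmentAverage_sub,
    ← translate_segmentAverage]
  rw [sum_mul_translate_sub, neg_neg]
  exact fun p hp => ⟨mem_knotIndex_of_ne_zero hc hp,
    add_mem_knotIndex_of_ne_zero hc hp (by simp [Prod.le_def])⟩

theorem lineDerivOp_stepDistr_apply₂ {c : ℤ × ℤ → ℝ} (hc : ∀ p ∉ pixelIndex n, c p = 0)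
    (φ : Test) : (∂_{knot n (0, 1)} (stepDistr n c)) φ =
      ∑ p ∈ knotIndex n, diff (0, 1) c p * segmentAverage (knot n (1, 0)) φ (knot n p) := by
  rw [Distribution.lineDerivOp_apply_apply, map_neg, stepDistr_apply_eq_sum_knotIndex hc]
  simp_rw [segmentAverage_lineDerivOp, segmentAverage_sub, ← translate_segmentAverage]
  rw [sum_mul_translate_sub, neg_neg]
  exact fun p hp => ⟨mem_knotIndex_of_ne_zero hc hp,
    add_mem_knotIndex_of_ne_zero hc hp (by simp [Prod.le_def])⟩

theorem lineDerivOp_lineDerivOp_stepDistr_apply {c : ℤ × ℤ → ℝ}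
    (hc : ∀ p ∉ pixelIndex n, c p = 0) (φ : Test) :
    (∂_{knot n (1, 0)} (∂_{knot n (0, 1)} (stepDistr n c))) φ =
      ∑ p ∈ knotIndex n, diff (1, 0) (diff (0, 1) c) p * φ (knot n p) := by
  rw [Distribution.lineDerivOp_apply_apply, map_neg, lineDerivOp_stepDistr_apply₂ hc]
  simp_rw [segmentAverage_lineDerivOp]
  rw [sum_mul_translate_sub fun p => mem_knotIndex_of_diff_ne_zero hc, neg_neg]

theorem integral_segmentMeasure_test (φ : Test) (x v : ℝ × ℝ) :
    ∫ y, φ y ∂segmentMeasure x v = segmentAverage v φ x :=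
  integral_segmentMeasure φ.continuous φ.hasCompactSupport x v

theorem normM_D₁_stepDistr {c : ℤ × ℤ → ℝ} (hc : ∀ p ∉ pixelIndex n, c p = 0) :
    normM (D₁ (stepDistr n c)) =
      ENNReal.ofReal (∑ p ∈ knotIndex n, |n * diff (1, 0) c p|) := by
  rw [D₁_eq_smul_lineDerivOp_knot n]
  refine (normM_le_sum_abs _ _ (fun p => segmentMeasure (knot n p) (knot n (0, 1)))
    fun φ => ?_).antisymm ?_
  · simp_rw [smul_apply, lineDerivOp_stepDistr_apply₁ hc, integral_segmentMeasure_test, mul_assoc,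
      ← Finset.mul_sum, smul_eq_mul]
  · simpa only [cellIntegral_stepFunction] using
      (isFunction_stepDistr (n := n) hc).sum_abs_diff_le_normM n n (1, 0) (knotIndex n)

theorem normM_D₂_stepDistr {c : ℤ × ℤ → ℝ} (hc : ∀ p ∉ pixelIndex n, c p = 0) :
    normM (D₂ (stepDistr n c)) =
      ENNReal.ofReal (∑ p ∈ knotIndex n, |n * diff (0, 1) c p|) := by
  rw [D₂_eq_smul_lineDerivOp_knot n]
  refine (normM_le_sum_abs _ _ (fun p => segmentMeasure (knot n p) (knot n (1, 0)))
    fun φ => ?_).antisymm ?_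
  · simp_rw [smul_apply, lineDerivOp_stepDistr_apply₂ hc, integral_segmentMeasure_test, mul_assoc,
      ← Finset.mul_sum, smul_eq_mul]
  · simpa only [cellIntegral_stepFunction] using
      (isFunction_stepDistr (n := n) hc).sum_abs_diff_le_normM n n (0, 1) (knotIndex n)

theorem D₁₂_stepDistr_apply {c : ℤ × ℤ → ℝ} (hc : ∀ p ∉ pixelIndex n, c p = 0) (φ : Test) :
    D₁₂ (stepDistr n c) φ = ∑ p ∈ knotIndex n, n ^ 2 * diff (1, 0) (diff (0, 1) c) p *
      ∫ x, φ x ∂Measure.dirac (knot n p) := by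
  simp_rw [D₁₂_eq_smul_lineDerivOp_knot n, smul_apply, lineDerivOp_lineDerivOp_stepDistr_apply hc,
    integral_dirac, mul_assoc, ← Finset.mul_sum, smul_eq_mul]

theorem normM_D₁₂_stepDistr {c : ℤ × ℤ → ℝ} (hc : ∀ p ∉ pixelIndex n, c p = 0) :
    normM (D₁₂ (stepDistr n c)) =
      ENNReal.ofReal (∑ p ∈ knotIndex n, |n ^ 2 * diff (1, 0) (diff (0, 1) c) p|) := by
  refine (normM_le_sum_abs _ _ _ (D₁₂_stepDistr_apply hc)).antisymm ?_
  rw [D₁₂_eq_smul_lineDerivOp_knot n]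
  simpa only [cellIntegral_stepFunction] using
    (isFunction_stepDistr (n := n) hc).sum_abs_diff_diff_le_normM n (n ^ 2) (1, 0) (0, 1)
      (knotIndex n)

theorem isMeasureOn_D₁₂_stepDistr {c : ℤ × ℤ → ℝ} (hc : ∀ p ∉ pixelIndex n, c p = 0)
    {A : Set (ℝ × ℝ)} (hA : ∀ p ∈ knotIndex n, knot n p ∈ A) :
    IsMeasureOn (D₁₂ (stepDistr n c)) A := by
  obtain ⟨m, hm, hvariation⟩ := exists_isMeasure_of_sum (knotIndex n) _
    (fun p => Measure.dirac (knot n p)) (D₁₂_stepDistr_apply hc)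
  refine ⟨m, hm, le_zero_iff.1 ((hvariation Aᶜ).trans_eq (Finset.sum_eq_zero fun p hp => ?_))⟩
  simp [Measure.dirac_apply, hA p hp]

theorem stepFunction_eq_zero {c : ℤ × ℤ → ℝ} (hc : ∀ p ∉ pixelIndex n, c p = 0) {x : ℝ × ℝ}
    (hx : x ∈ Kᶜ) : stepFunction n c x = 0 := by
  rw [stepFunction, hc, mul_zero]
  rw [cellIndex_mem_pixelIndex]
  exact fun h => hx (prod_mono Ico_subset_Icc_self Ico_subset_Icc_self h)

theorem isVanishingOn_stepDistr {c : ℤ × ℤ → ℝ} (hc : ∀ p ∉ pixelIndex n, c p = 0) :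
    Distribution.IsVanishingOn (stepDistr n c) Kᶜ := fun φ hφ => by
  rw [(isFunction_stepDistr hc).2]
  refine integral_eq_zero_of_ae (.of_forall fun x => ?_)
  by_cases hx : x ∈ Kᶜ
  · simp [stepFunction_eq_zero hc hx]
  · simp [image_eq_zero_of_notMem_tsupport fun h => hx (hφ h)]

theorem stepDistr_apply_nonneg {c : ℤ × ℤ → ℝ} (hc : ∀ p ∉ pixelIndex n, c p = 0)
    (hc₀ : 0 ≤ c) {φ : Test} (hφ : ∀ x, 0 ≤ φ x) : 0 ≤ stepDistr n c φ := by
  rw [(isFunction_stepDistr hc).2]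
  exact integral_nonneg fun x => mul_nonneg (mul_nonneg (by positivity) (hc₀ _)) (hφ x)

end StepDistribution

section NativeSpace

theorem isFunction_cdf_of_variation_compl_K {f : Distr} (hf : Distribution.IsVanishingOn f Kᶜ)
    {m : SignedMeasure (ℝ × ℝ)} (hm : IsMeasure (D₁₂ f) m) (hm₀ : m.variation Kᶜ = 0) :
    IsFunction f (cdf m) := by
  have hK : (Ici 0)ᶜ ⊆ Kᶜ := compl_subset_compl.2 fun x hx => ⟨hx.1.1, hx.2.1⟩
  exact isFunction_cdf (hf.mono hK) hm (measure_mono_null hK hm₀)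

theorem isFunction_density {f : Distr} (hf : f ∈ native) : IsFunction f (density f) := by
  obtain ⟨⟨m, hm, hm₀⟩, hvanish⟩ := hf
  exact (isFunction_cdf_of_variation_compl_K hvanish hm hm₀).density

theorem K_ae_eq_Ico : K =ᵐ[volume] Ico (0 : ℝ) 1 ×ˢ Ico (0 : ℝ) 1 :=
  Measure.set_prod_ae_eq Ico_ae_eq_Icc.symm Ico_ae_eq_Icc.symm

/-- The index of the cell that corresponds to the pixel `(i, j)`. -/
def pixelCoord {n : ℕ} (q : Fin n × Fin n) : ℤ × ℤ := ((q.1 : ℕ), (q.2 : ℕ))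

theorem pixel_ae_eq_cell (N : ℕ) (q : Fin (2 ^ N) × Fin (2 ^ N)) :
    pixel N q.1 q.2 =ᵐ[volume] cell (2 ^ N) (pixelCoord q) := by
  have hpixel : pixel N q.1 q.2 =
      Icc (knot (2 ^ N) (pixelCoord q)) (knot (2 ^ N) (pixelCoord q + 1)) := by
    rw [pixel, Icc_prod_eq]
    simp [knot, pixelCoord]
  exact hpixel ▸ (cell_ae_eq_Icc _).symm

theorem pixelIntegrals_eq_cellIntegral (N : ℕ) (f : Distr) (q : Fin (2 ^ N) × Fin (2 ^ N)) :
    pixelIntegrals N f q.1 q.2 = cellIntegral (2 ^ N) (density f) (pixelCoord q) :=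
  setIntegral_congr_set (pixel_ae_eq_cell N q)

theorem IsFunction.cellIntegral_density {f : Distr} {g : ℝ × ℝ → ℝ} (h : IsFunction f g)
    (n : ℕ) : cellIntegral n (MixedTV.density f) = cellIntegral n g :=
  funext fun _ => integral_congr_ae (ae_restrict_of_ae (h.density.ae_eq h))

variable {n : ℕ} [NeZero n]

theorem cellIntegral_density_eq_zero {f : Distr} (hf : f ∈ native) {p : ℤ × ℤ}
    (hp : p ∉ pixelIndex n) : cellIntegral n (density f) p = 0 := by
  have hzero : ∀ᵐ x, x ∈ Kᶜ → density f x = 0 :=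
    (isFunction_density hf).ae_eq_zero_of_isVanishingOn
      (isClosed_Icc.prod isClosed_Icc).isOpen_compl hf.2
  refine integral_eq_zero_of_ae ((ae_restrict_iff' (measurableSet_cell p)).2 ?_)
  filter_upwards [hzero, K_ae_eq_Ico.mem_iff] with x hx hK hxp
  rw [← hxp.out, cellIndex_mem_pixelIndex, ← hK] at hp
  exact hx hp

theorem cellIntegral_density_nonneg {f : Distr} (hf : f ∈ nativePos) :
    0 ≤ cellIntegral n (density f) := fun p => by
  obtain ⟨ψ, hψ⟩ := exists_approximatesIndicator_interior_cell (n := n)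
  exact ge_of_tendsto' ((isFunction_density hf.1).tendsto_apply_translate hψ p)
    fun k => hf.2 _ fun x => hψ.nonneg k _

theorem cellIntegral_density_stepDistr {c : ℤ × ℤ → ℝ} (hc : ∀ p ∉ pixelIndex n, c p = 0) :
    cellIntegral n (density (stepDistr n c)) = c := by
  rw [(isFunction_stepDistr hc).cellIntegral_density, cellIntegral_stepFunction]

end NativeSpace

section GridMeasure

theorem knot_mono (n : ℕ) : Monotone (knot n) := fun _ _ hpq =>
  ⟨div_le_div_of_nonneg_right (Int.cast_le.2 hpq.1) n.cast_nonneg,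
    div_le_div_of_nonneg_right (Int.cast_le.2 hpq.2) n.cast_nonneg⟩

theorem grid_eq_image_knot (N : ℕ) : grid N = knot (2 ^ N) '' knotIndex (2 ^ N) := by
  ext x
  constructor
  · rintro ⟨i, j, hi, hj, rfl⟩
    refine ⟨(i, j), ?_, by simp [knot]⟩
    simp only [knotIndex, Finset.coe_product, Finset.coe_Icc, mem_prod, mem_Icc]
    exact ⟨⟨i.cast_nonneg, mod_cast hi⟩, j.cast_nonneg, mod_cast hj⟩
  · rintro ⟨⟨i, j⟩, hij, rfl⟩
    simp only [knotIndex, Finset.coe_product, Finset.coe_Icc, mem_prod, mem_Icc] at hij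
    lift i to ℕ using hij.1.1
    lift j to ℕ using hij.2.1
    exact ⟨i, j, by exact_mod_cast hij.1.2, by exact_mod_cast hij.2.2, by simp [knot]⟩

theorem knot_mem_grid {N : ℕ} {p : ℤ × ℤ} (hp : p ∈ knotIndex (2 ^ N)) :
    knot (2 ^ N) p ∈ grid N :=
  grid_eq_image_knot N ▸ mem_image_of_mem _ hp

variable {n : ℕ} [NeZero n]

theorem knot_le_iff {p : ℤ × ℤ} {x : ℝ × ℝ} : knot n p ≤ x ↔ p ≤ cellIndex n x := by
  have hn : (0 : ℝ) < n := Nat.cast_pos.2 (NeZero.pos n)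
  simp [knot, cellIndex, Prod.le_def, Int.le_floor, div_le_iff₀ hn, mul_comm]

theorem cdf_eq_cdf_knot_cellIndex {m : SignedMeasure (ℝ × ℝ)}
    (hm : m.variation (range (knot n))ᶜ = 0) (x : ℝ × ℝ) :
    cdf m x = cdf m (knot n (cellIndex n x)) := by
  have hsub : Iic (knot n (cellIndex n x)) ⊆ Iic x := Iic_subset_Iic.2 (knot_le_iff.2 le_rfl)
  have hdiff : Iic x \ Iic (knot n (cellIndex n x)) ⊆ (range (knot n))ᶜ := by
    rintro _ ⟨hle : _ ≤ x, hnot⟩ ⟨p, rfl⟩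
    rw [knot_le_iff] at hle
    exact hnot (knot_mono n hle)
  have hzero : m (Iic x \ Iic (knot n (cellIndex n x))) = 0 := by
    rw [← enorm_eq_zero, ← le_zero_iff, ← measure_mono_null hdiff hm]
    exact m.enorm_measure_le_variation _
  rw [cdf, cdf, ← m.of_add_of_sdiff measurableSet_Iic measurableSet_Iic hsub, hzero, add_zero]

theorem cdf_eq_stepFunction {m : SignedMeasure (ℝ × ℝ)}
    (hm : m.variation (range (knot n))ᶜ = 0) :
    cdf m = stepFunction n fun p => cdf m (knot n p) / n ^ 2 := by
  have hn : (n : ℝ) ≠ 0 := NeZero.ne _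
  ext x
  rw [stepFunction, ← cdf_eq_cdf_knot_cellIndex hm]
  field_simp

theorem stepDistr_cellIntegral_density {f : Distr} (hf : f ∈ native)
    (hmeasure : IsMeasureOn (D₁₂ f) (K ∩ range (knot n))) :
    stepDistr n (cellIntegral n (density f)) = f := by
  obtain ⟨m, hm, hm₀⟩ := hmeasure
  have hcdf := isFunction_cdf_of_variation_compl_K hf.2 hm
    (measure_mono_null (compl_subset_compl.2 inter_subset_left) hm₀)
  have hstep := cdf_eq_stepFunction
    (measure_mono_null (compl_subset_compl.2 inter_subset_right) hm₀)
  refine (isFunction_stepDistr (n := n) fun p => cellIntegral_density_eq_zero hf).eq hcdf ?_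
  rw [hcdf.cellIntegral_density, hstep, cellIntegral_stepFunction]

end GridMeasure

section Penalty

/-- The value of `‖·‖_θ` on the step distribution with cell integrals `c`. -/
def penalty (n : ℕ) (θ : ℝ) (c : ℤ × ℤ → ℝ) : ℝ :=
  θ * ∑ p ∈ knotIndex n, |n ^ 2 * diff (1, 0) (diff (0, 1) c) p| +
    (1 - θ) * (∑ p ∈ knotIndex n, |n * diff (0, 1) c p| + ∑ p ∈ knotIndex n, |n * diff (1, 0) c p|)

theorem continuous_penalty (n : ℕ) (θ : ℝ) : Continuous (penalty n θ) := by
  unfold penalty diff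
  fun_prop

theorem convexOn_sum_abs {E ι : Type*} [AddCommGroup E] [Module ℝ E] (S : Finset ι)
    {ℓ : ι → E → ℝ} (hℓ : ∀ i, IsLinearMap ℝ (ℓ i)) :
    ConvexOn ℝ univ fun x => ∑ i ∈ S, |ℓ i x| := by
  refine ⟨convex_univ, fun x _ y _ a b ha hb _ => ?_⟩
  simp only [smul_eq_mul, Finset.mul_sum, ← Finset.sum_add_distrib]
  refine Finset.sum_le_sum fun i _ => ?_
  rw [(hℓ i).map_add, (hℓ i).map_smul, (hℓ i).map_smul, smul_eq_mul, smul_eq_mul]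
  refine (abs_add_le _ _).trans_eq ?_
  rw [abs_mul, abs_mul, abs_of_nonneg ha, abs_of_nonneg hb]

theorem isLinearMap_mul_diff (a : ℝ) (e p : ℤ × ℤ) : IsLinearMap ℝ fun c => a * diff e c p where
  map_add c d := by simp only [diff, Pi.add_apply]; ring
  map_smul r c := by simp only [diff, Pi.smul_apply, smul_eq_mul]; ring

theorem isLinearMap_mul_diff_diff (a : ℝ) (e e' p : ℤ × ℤ) :
    IsLinearMap ℝ fun c => a * diff e (diff e' c) p where
  map_add c d := by simp only [diff, Pi.add_apply]; ring
  map_smul r c := by simp only [diff, Pi.smul_apply, smul_eq_mul]; ring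

theorem convexOn_penalty (n : ℕ) {θ : ℝ} (hθ₀ : 0 ≤ θ) (hθ₁ : θ ≤ 1) :
    ConvexOn ℝ univ (penalty n θ) :=
  ((convexOn_sum_abs _ fun p => isLinearMap_mul_diff_diff _ _ _ p).smul hθ₀).add
    (((convexOn_sum_abs _ fun p => isLinearMap_mul_diff _ _ p).add
      (convexOn_sum_abs _ fun p => isLinearMap_mul_diff _ _ p)).smul (sub_nonneg.2 hθ₁))

theorem penalty_nonneg (n : ℕ) {θ : ℝ} (hθ₀ : 0 ≤ θ) (hθ₁ : θ ≤ 1) (c : ℤ × ℤ → ℝ) :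
    0 ≤ penalty n θ c := by
  have := sub_nonneg.2 hθ₁
  unfold penalty
  positivity

theorem ofReal_penalty (n : ℕ) {θ : ℝ} (hθ₀ : 0 ≤ θ) (hθ₁ : θ ≤ 1) (c : ℤ × ℤ → ℝ) :
    ENNReal.ofReal (penalty n θ c) = ENNReal.ofReal θ *
        ENNReal.ofReal (∑ p ∈ knotIndex n, |n ^ 2 * diff (1, 0) (diff (0, 1) c) p|) +
      ENNReal.ofReal (1 - θ) * (ENNReal.ofReal (∑ p ∈ knotIndex n, |n * diff (0, 1) c p|) +
        ENNReal.ofReal (∑ p ∈ knotIndex n, |n * diff (1, 0) c p|)) := by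
  have := sub_nonneg.2 hθ₁
  rw [penalty, ENNReal.ofReal_add (by positivity) (by positivity), ENNReal.ofReal_mul hθ₀,
    ENNReal.ofReal_mul this, ENNReal.ofReal_add (by positivity) (by positivity)]

variable {n : ℕ} [NeZero n]

theorem normTheta_stepDistr {θ : ℝ} (hθ₀ : 0 ≤ θ) (hθ₁ : θ ≤ 1) {c : ℤ × ℤ → ℝ}
    (hc : ∀ p ∉ pixelIndex n, c p = 0) :
    normTheta θ (stepDistr n c) = ENNReal.ofReal (penalty n θ c) := by
  rw [normTheta, normM_D₁₂_stepDistr hc, normM_D₁_stepDistr hc, normM_D₂_stepDistr hc,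
    ofReal_penalty n hθ₀ hθ₁]

variable (n) in
theorem IsFunction.ofReal_penalty_cellIntegral_le_normTheta {θ : ℝ} (hθ₀ : 0 ≤ θ) (hθ₁ : θ ≤ 1)
    {f : Distr} {g : ℝ × ℝ → ℝ} (h : IsFunction f g) :
    ENNReal.ofReal (penalty n θ (cellIntegral n g)) ≤ normTheta θ f := by
  rw [ofReal_penalty n hθ₀ hθ₁, normTheta, D₁₂_eq_smul_lineDerivOp_knot n,
    D₁_eq_smul_lineDerivOp_knot n, D₂_eq_smul_lineDerivOp_knot n]
  gcongr
  · exact h.sum_abs_diff_diff_le_normM n _ _ _ _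
  · exact h.sum_abs_diff_le_normM n _ _ _
  · exact h.sum_abs_diff_le_normM n _ _ _

end Penalty

section ProximalPoint

variable {E : Type*} [NormedAddCommGroup E] [InnerProductSpace ℝ E]

theorem strictConvexOn_norm_sub_sq_add {C : Set E} {R : E → ℝ} (hR : ConvexOn ℝ C R) (y : E) :
    StrictConvexOn ℝ C fun x => ‖y - x‖ ^ 2 + R x := by
  refine StrongConvexOn.strictConvexOn (m := 2) (strongConvexOn_iff_convex.2 ?_) two_pos
  have hlin : ConvexOn ℝ C fun x => (-2 : ℝ) • innerₗ E y x + ‖y‖ ^ 2 :=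
    (((-2 : ℝ) • innerₗ E y).convexOn hR.1).add_const _
  refine (hlin.add hR).congr fun x _ => ?_
  simp only [Pi.add_apply, innerₗ_apply_apply, smul_eq_mul]
  rw [norm_sub_sq_real]
  ring

theorem exists_forall_le_norm_sub_sq_add [FiniteDimensional ℝ E] {C : Set E} (hC : IsClosed C)
    (hne : C.Nonempty) {R : E → ℝ} (hR : ContinuousOn R C) (hR₀ : ∀ x ∈ C, 0 ≤ R x) (y : E) :
    ∃ x ∈ C, ∀ z ∈ C, ‖y - x‖ ^ 2 + R x ≤ ‖y - z‖ ^ 2 + R z := by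
  obtain ⟨x₀, hx₀⟩ := hne
  have hcont : ContinuousOn (fun x => ‖y - x‖ ^ 2 + R x) C := by fun_prop
  refine hcont.exists_isMinOn' hC hx₀ (eventually_inf_principal.2 ?_)
  have hcoercive : Tendsto (fun z => ‖y - z‖ ^ 2) (cocompact E) atTop :=
    (tendsto_pow_atTop two_ne_zero).comp
      (tendsto_norm_cocompact_atTop.comp (Homeomorph.subLeft y).isClosedEmbedding.tendsto_cocompact)
  filter_upwards [hcoercive.eventually_ge_atTop (‖y - x₀‖ ^ 2 + R x₀)] with z hz hzC
  exact hz.trans (le_add_of_nonneg_right (hR₀ z hzC))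

theorem exists_unique_forall_le_norm_sub_sq_add [FiniteDimensional ℝ E] {C : Set E}
    (hC : IsClosed C) (hne : C.Nonempty) {R : E → ℝ} (hconvex : ConvexOn ℝ C R)
    (hR : ContinuousOn R C) (hR₀ : ∀ x ∈ C, 0 ≤ R x) (y : E) :
    ∃ x ∈ C, (∀ z ∈ C, ‖y - x‖ ^ 2 + R x ≤ ‖y - z‖ ^ 2 + R z) ∧
      ∀ z ∈ C, ‖y - z‖ ^ 2 + R z ≤ ‖y - x‖ ^ 2 + R x → z = x := by
  obtain ⟨x, hx, hmin⟩ := exists_forall_le_norm_sub_sq_add hC hne hR hR₀ y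
  exact ⟨x, hx, hmin, fun z hz hle => (strictConvexOn_norm_sub_sq_add hconvex y).eq_of_isMinOn
    (fun w hw => hle.trans (hmin w hw)) hmin hz hx⟩

end ProximalPoint

section PixelProjection

theorem pixelCoord_injective {n : ℕ} : Function.Injective (pixelCoord (n := n)) := fun p q h => by
  simpa [pixelCoord, Prod.ext_iff, Fin.ext_iff] using h

theorem mem_pixelIndex_iff {n : ℕ} {p : ℤ × ℤ} :
    p ∈ pixelIndex n ↔ p ∈ range (pixelCoord (n := n)) := by
  obtain ⟨i, j⟩ := p
  simp only [pixelIndex, Finset.mem_product, Finset.mem_Ico]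
  constructor
  · rintro ⟨⟨hi₀, hi⟩, hj₀, hj⟩
    lift i to ℕ using hi₀
    lift j to ℕ using hj₀
    exact ⟨(⟨i, mod_cast hi⟩, ⟨j, mod_cast hj⟩), rfl⟩
  · rintro ⟨q, hq⟩
    obtain ⟨rfl, rfl⟩ := Prod.ext_iff.1 hq
    simp [pixelCoord]

/-- Arrays of `n × n` pixel values, with the Euclidean norm. -/
abbrev PixelArray (n : ℕ) : Type := EuclideanSpace ℝ (Fin n × Fin n)

/-- The extension of a pixel array by zero to the whole lattice. -/
def zeroExtend (n : ℕ) : PixelArray n →ₗ[ℝ] ℤ × ℤ → ℝ :=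
  Function.ExtendByZero.linearMap ℝ pixelCoord ∘ₗ (WithLp.linearEquiv 2 ℝ _).toLinearMap

theorem zeroExtend_pixelCoord {n : ℕ} (x : PixelArray n) (q : Fin n × Fin n) :
    zeroExtend n x (pixelCoord q) = x q :=
  pixelCoord_injective.extend_apply _ _ _

theorem zeroExtend_eq_zero {n : ℕ} (x : PixelArray n) {p : ℤ × ℤ}
    (hp : p ∉ pixelIndex n) : zeroExtend n x p = 0 :=
  Function.extend_apply' _ _ _ (mt mem_pixelIndex_iff.2 hp)

theorem zeroExtend_nonneg {n : ℕ} {x : PixelArray n} (hx : ∀ q, 0 ≤ x q) :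
    0 ≤ zeroExtend n x := fun p => by
  by_cases hp : p ∈ pixelIndex n
  · obtain ⟨q, rfl⟩ := mem_pixelIndex_iff.1 hp
    exact (hx q).trans_eq (zeroExtend_pixelCoord x q).symm
  · exact (zeroExtend_eq_zero x hp).ge

/-- The measurements of `f` as a vector. -/
def pixelVector (N : ℕ) (f : Distr) : PixelArray (2 ^ N) :=
  WithLp.toLp 2 fun q => pixelIntegrals N f q.1 q.2

/-- The step distribution whose measurements are the entries of `x`. -/
def pixelDistr (N : ℕ) (x : PixelArray (2 ^ N)) : Distr :=
  stepDistr (2 ^ N) (zeroExtend (2 ^ N) x)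

theorem zeroExtend_pixelVector {N : ℕ} {f : Distr} (hf : f ∈ native) :
    zeroExtend (2 ^ N) (pixelVector N f) = cellIntegral (2 ^ N) (density f) := by
  ext p
  by_cases hp : p ∈ pixelIndex (2 ^ N)
  · obtain ⟨q, rfl⟩ := mem_pixelIndex_iff.1 hp
    rw [zeroExtend_pixelCoord, ← pixelIntegrals_eq_cellIntegral]
    rfl
  · rw [zeroExtend_eq_zero _ hp, cellIntegral_density_eq_zero hf hp]

theorem pixelVector_pixelDistr {N : ℕ} (x : PixelArray (2 ^ N)) :
    pixelVector N (pixelDistr N x) = x := by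
  ext q
  change pixelIntegrals N (pixelDistr N x) q.1 q.2 = x q
  rw [pixelIntegrals_eq_cellIntegral, pixelDistr,
    cellIntegral_density_stepDistr fun p => zeroExtend_eq_zero x, zeroExtend_pixelCoord]

theorem pixelVector_nonneg {N : ℕ} {f : Distr} (hf : f ∈ nativePos)
    (q : Fin (2 ^ N) × Fin (2 ^ N)) : 0 ≤ pixelVector N f q :=
  (cellIntegral_density_nonneg hf _).trans_eq (pixelIntegrals_eq_cellIntegral N f q).symm

theorem grid_subset_K (N : ℕ) : grid N ⊆ K := by
  rintro _ ⟨i, j, hi, hj, rfl⟩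
  have hpow : (0 : ℝ) < 2 ^ N := by positivity
  exact ⟨⟨by positivity, (div_le_one hpow).2 (mod_cast hi)⟩,
    ⟨by positivity, (div_le_one hpow).2 (mod_cast hj)⟩⟩

theorem IsMeasureOn.mono {T : Distr} {A B : Set (ℝ × ℝ)} (hT : IsMeasureOn T A) (hAB : A ⊆ B) :
    IsMeasureOn T B :=
  hT.imp fun _ hm => ⟨hm.1, measure_mono_null (compl_subset_compl.2 hAB) hm.2⟩

theorem pixelDistr_mem_nativePosGrid {N : ℕ} {x : PixelArray (2 ^ N)}
    (hx : ∀ q, 0 ≤ x q) : pixelDistr N x ∈ nativePosGrid N := by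
  have hzero : ∀ p ∉ pixelIndex (2 ^ N), zeroExtend (2 ^ N) x p = 0 :=
    fun p => zeroExtend_eq_zero x
  have hmeasure : IsMeasureOn (D₁₂ (pixelDistr N x)) (grid N) :=
    isMeasureOn_D₁₂_stepDistr hzero fun p => knot_mem_grid
  exact ⟨⟨⟨hmeasure.mono (grid_subset_K N), isVanishingOn_stepDistr hzero⟩,
    fun φ => stepDistr_apply_nonneg hzero (zeroExtend_nonneg hx)⟩, hmeasure⟩

theorem pixelDistr_pixelVector {N : ℕ} {f : Distr} (hf : f ∈ nativePosGrid N) :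
    pixelDistr N (pixelVector N f) = f := by
  rw [pixelDistr, zeroExtend_pixelVector hf.1.1]
  refine stepDistr_cellIntegral_density hf.1.1 (hf.2.mono (subset_inter (grid_subset_K N) ?_))
  rw [grid_eq_image_knot]
  exact image_subset_range _ _

/-- The denoising functional on pixel arrays: the loss of the corresponding step distribution. -/
def pixelLoss (N : ℕ) (y : Fin (2 ^ N) → Fin (2 ^ N) → ℝ) (lam θ : ℝ)
    (x : PixelArray (2 ^ N)) : ℝ :=
  ‖WithLp.toLp 2 (Function.uncurry y) - x‖ ^ 2 + lam * penalty (2 ^ N) θ (zeroExtend (2 ^ N) x)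

section Loss

variable {N : ℕ} {y : Fin (2 ^ N) → Fin (2 ^ N) → ℝ} {lam θ : ℝ}

theorem loss_eq (f : Distr) : loss N y lam θ f =
    ENNReal.ofReal (‖WithLp.toLp 2 (Function.uncurry y) - pixelVector N f‖ ^ 2) +
      ENNReal.ofReal lam * normTheta θ f := by
  rw [loss, EuclideanSpace.real_norm_sq_eq, Fintype.sum_prod_type]
  rfl

theorem ofReal_pixelLoss (hlam : 0 ≤ lam) (hθ₀ : 0 ≤ θ) (hθ₁ : θ ≤ 1)
    (x : PixelArray (2 ^ N)) :
    ENNReal.ofReal (pixelLoss N y lam θ x) =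
      ENNReal.ofReal (‖WithLp.toLp 2 (Function.uncurry y) - x‖ ^ 2) +
        ENNReal.ofReal lam * ENNReal.ofReal (penalty (2 ^ N) θ (zeroExtend (2 ^ N) x)) := by
  rw [pixelLoss, ENNReal.ofReal_add (by positivity)
    (mul_nonneg hlam (penalty_nonneg _ hθ₀ hθ₁ _)), ENNReal.ofReal_mul hlam]

theorem loss_pixelDistr (hlam : 0 ≤ lam) (hθ₀ : 0 ≤ θ) (hθ₁ : θ ≤ 1)
    (x : PixelArray (2 ^ N)) :
    loss N y lam θ (pixelDistr N x) = ENNReal.ofReal (pixelLoss N y lam θ x) := by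
  rw [loss_eq, ofReal_pixelLoss hlam hθ₀ hθ₁, pixelVector_pixelDistr, pixelDistr,
    normTheta_stepDistr hθ₀ hθ₁ fun p => zeroExtend_eq_zero x]

theorem ofReal_pixelLoss_pixelVector_le_loss (hlam : 0 ≤ lam) (hθ₀ : 0 ≤ θ) (hθ₁ : θ ≤ 1)
    {f : Distr} (hf : f ∈ native) :
    ENNReal.ofReal (pixelLoss N y lam θ (pixelVector N f)) ≤ loss N y lam θ f := by
  rw [loss_eq, ofReal_pixelLoss hlam hθ₀ hθ₁, zeroExtend_pixelVector hf]
  gcongr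
  exact (isFunction_density hf).ofReal_penalty_cellIntegral_le_normTheta _ hθ₀ hθ₁

theorem pixelLoss_nonneg (hlam : 0 ≤ lam) (hθ₀ : 0 ≤ θ) (hθ₁ : θ ≤ 1)
    (x : PixelArray (2 ^ N)) : 0 ≤ pixelLoss N y lam θ x :=
  add_nonneg (by positivity) (mul_nonneg hlam (penalty_nonneg _ hθ₀ hθ₁ _))

theorem exists_unique_forall_pixelLoss_le (hlam : 0 ≤ lam) (hθ₀ : 0 ≤ θ) (hθ₁ : θ ≤ 1) :
    ∃ x : PixelArray (2 ^ N), (∀ q, 0 ≤ x q) ∧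
      (∀ z, (∀ q, 0 ≤ z q) → pixelLoss N y lam θ x ≤ pixelLoss N y lam θ z) ∧
      ∀ z, (∀ q, 0 ≤ z q) → pixelLoss N y lam θ z ≤ pixelLoss N y lam θ x → z = x := by
  have hconvex : ConvexOn ℝ univ (penalty (2 ^ N) θ ∘ zeroExtend (2 ^ N)) :=
    (convexOn_penalty (2 ^ N) hθ₀ hθ₁).comp_linearMap (zeroExtend (2 ^ N))
  have hcont : Continuous (penalty (2 ^ N) θ ∘ zeroExtend (2 ^ N)) :=
    (continuous_penalty (2 ^ N) θ).comp (zeroExtend (2 ^ N)).continuous_of_finiteDimensional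
  have hclosed : IsClosed {x : PixelArray (2 ^ N) | ∀ q, 0 ≤ x q} := by
    simp only [ofPred_forall]
    exact isClosed_iInter fun q => isClosed_le continuous_const (by fun_prop)
  have hC : Convex ℝ {x : PixelArray (2 ^ N) | ∀ q, 0 ≤ x q} :=
    fun x hx z hz a b ha hb _ q =>
      add_nonneg (mul_nonneg ha (hx q)) (mul_nonneg hb (hz q))
  exact exists_unique_forall_le_norm_sub_sq_add hclosed ⟨0, fun _ => le_rfl⟩
    ((hconvex.smul hlam).subset (subset_univ _) hC) (hcont.const_smul lam).continuousOn
    (fun x _ => mul_nonneg hlam (penalty_nonneg _ hθ₀ hθ₁ _)) _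

end Loss

end PixelProjection

end MixedTV

end

theorem mainTheorem4 (N : ℕ) (y : Fin (2 ^ N) → Fin (2 ^ N) → ℝ) (lam θ : ℝ)
    (hlam : 0 ≤ lam) (hθ₀ : 0 < θ) (hθ₁ : θ ≤ 1) :
    ∃ f : MixedTV.Distr,
      MixedTV.gridSolutions N y lam θ N = {f} ∧
      f ∈ MixedTV.solutions N y lam θ ∧
      ∀ g ∈ MixedTV.solutions N y lam θ, g ∈ MixedTV.nativePosGrid N → g = f := by
  open MixedTV in
  obtain ⟨x, hx, hmin, hunique⟩ := exists_unique_forall_pixelLoss_le (y := y) hlam hθ₀.le hθ₁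
  have hmem : pixelDistr N x ∈ nativePosGrid N := pixelDistr_mem_nativePosGrid hx
  have hle (g) (hg : g ∈ nativePos) : loss N y lam θ (pixelDistr N x) ≤ loss N y lam θ g := by
    rw [loss_pixelDistr hlam hθ₀.le hθ₁]
    exact (ENNReal.ofReal_le_ofReal (hmin _ (pixelVector_nonneg hg))).trans
      (ofReal_pixelLoss_pixelVector_le_loss hlam hθ₀.le hθ₁ hg.1)
  have heq (g) (hg : g ∈ nativePosGrid N)
      (hloss : loss N y lam θ g ≤ loss N y lam θ (pixelDistr N x)) : g = pixelDistr N x := by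
    rw [← pixelDistr_pixelVector hg] at hloss ⊢
    rw [loss_pixelDistr hlam hθ₀.le hθ₁, loss_pixelDistr hlam hθ₀.le hθ₁,
      ENNReal.ofReal_le_ofReal_iff (pixelLoss_nonneg hlam hθ₀.le hθ₁ x)] at hloss
    rw [hunique _ (pixelVector_nonneg hg.1) hloss]
  refine ⟨pixelDistr N x, subset_antisymm ?_ ?_, ⟨hmem.1, hle⟩, ?_⟩
  · exact fun g hg => heq g hg.1 (hg.2 _ hmem)
  · exact singleton_subset_iff.2 ⟨hmem, fun g hg => hle g hg.1⟩
  · exact fun g hg hgrid => heq g hgrid (hg.2 _ hmem.1)
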